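/- For finite groups $G,H$ let $\mathbb{F}_2B(G)=\mathbb{F}_2\otimes_{\mathbb Z}B(G)$, where $B(G)$ is the Burnside group of finite $G$-sets, and let $\mathbb{F}_2B(H,G)=\mathbb{F}_2B(H\times G^{op})$ be the corresponding group for finite $(H,G)$-bisets. Each $\alpha\in\mathbb{F}_2B(H,G)$ induces a linear map $\mathbb{F}_2B(\alpha):\mathbb{F}_2B(G)\to\mathbb{F}_2B(H)$, obtained by extending $([U],[X])\mapsto[U\times_GX]$ bilinearly. A subfunctor $M$ of the biset functor $\mathbb{F}_2B$ is a family of subspaces $M(G)\subseteq\mathbb{F}_2B(G)$, for all finite groups $G$, with $\mathbb{F}_2B(\alpha)(M(G))\subseteq M(H)$ for all $G,H$ and all $\alpha\in\mathbb{F}_2B(H,G)$. For a set $\mathcal G$ of pairs $(R,v)$ with $R$ a finite group and $v\in\mathbb{F}_2B(R)$, let $\langle\mathcal G\rangle$ be the subfunctor generated by $\mathcal G$, i.e. the intersection of all subfunctors $M$ such that $v\in M(R)$ for all $(R,v)\in\mathcal G$. Let $\mathcal S$ be a set of finite groups consisting of exactly one group of order $p$ for each odd prime $p$, exactly one cyclic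 group of order $4$, and exactly one semidihedral group $SD_{2^n}$ of order $2^n$ for each $n\ge4$. For $R\in\mathcal S$ let $\overline{\varepsilon}_R\in\mathbb{F}_2B(R)$ be the class of - $R/\mathbf 1-R/R$ if $R$ has odd prime order, - $R/\mathbf 1-R/T$ if $R$ is cyclic of order $4$, where $T$ is the subgroup of order $2$ of $R$, - $R/I-R/IZ$ if $R$ is semidihedral, where $I$ is a non-central subgroup of order $2$ of $R$ and $Z$ is the center of $R$. For $\mathcal S'\subseteq\mathcal S$ let $\mathcal G_{\mathcal S'}=\{(R,\overline{\varepsilon}_R)\mid R\in\mathcal S'\}$, and let $L=\langle\mathcal G_{\mathcal S}\rangle$. Then $\mathcal G_{\mathcal S}$ is a minimal generating set of $L$: it generates $L$, and no proper subset of it does. Moreover, for every proper subset $\mathcal S'\subsetneq\mathcal S$, the subfunctor $\langle\mathcal G_{\mathcal S'}\rangle$ is a proper subfunctor of $L$. -/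

import Mathlib

noncomputable section

namespace BisetTheory

/-! ### Finite `G`-sets -/

/-- A finite (left) `G`-set. -/
structure FinGSet (G : Type) [Group G] : Type 1 where
  carrier : Type
  [action : MulAction G carrier]
  [finite : Finite carrier]

attribute [instance] FinGSet.action FinGSet.finite

namespace FinGSet

variable {G : Type} [Group G]

/-- Isomorphism of `G`-sets. -/
def Iso (X Y : FinGSet G) : Prop :=
  ∃ e : X.carrier ≃ Y.carrier, ∀ (g : G) (x : X.carrier), e (g • x) = g • e x

/-- Disjoint union of `G`-sets. -/
def disjUnion (X Y : FinGSet G) : FinGSet G where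
  carrier := X.carrier ⊕ Y.carrier

/-- The transitive `G`-set `G/H`. -/
def coset (G : Type) [Group G] [Finite G] (H : Subgroup G) : FinGSet G where
  carrier := G ⧸ H

end FinGSet

/-! ### Burnside groups -/

/-- The defining relations of the Burnside group: isomorphic `G`-sets have the same class, and
`[X ⊔ Y] = [X] + [Y]`. -/
def burnsideRel (k : Type) [CommRing k] (G : Type) [Group G] : Set (FinGSet G →₀ k) :=
  {v | ∃ X Y : FinGSet G, X.Iso Y ∧ v = Finsupp.single X 1 - Finsupp.single Y 1} ∪
  {v | ∃ X Y : FinGSet G,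
    v = Finsupp.single (X.disjUnion Y) 1 - Finsupp.single X 1 - Finsupp.single Y 1}

/-- `kB(G) = k ⊗ B(G)`: the `k`-module generated by the finite `G`-sets, subject to the relations
`burnsideRel`. For `k = ℤ` this is the (additive group of the) Burnside ring `B(G)`. -/
abbrev Burnside (k : Type) [CommRing k] (G : Type) [Group G] : Type 1 :=
  (FinGSet G →₀ k) ⧸ Submodule.span k (burnsideRel k G)

namespace Burnside

variable (k : Type) [CommRing k] {G : Type} [Group G]

/-- The class `[X]` of a finite `G`-set `X` in `kB(G)`. -/
def cls (X : FinGSet G) : Burnside k G :=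
  Submodule.Quotient.mk (Finsupp.single X 1)

variable {k}

theorem cls_eq_of_iso {X Y : FinGSet G} (h : X.Iso Y) : cls k X = cls k Y := by
  refine (Submodule.Quotient.eq _).2 (Submodule.subset_span (Or.inl ⟨X, Y, h, rfl⟩))

theorem cls_disjUnion (X Y : FinGSet G) : cls k (X.disjUnion Y) = cls k X + cls k Y := by
  refine (Submodule.Quotient.eq (p := Submodule.span k (burnsideRel k G))
    (y := Finsupp.single X 1 + Finsupp.single Y 1)).2 (Submodule.subset_span (Or.inr ⟨X, Y, ?_⟩))
  rw [sub_sub]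

/-- A map on finite `G`-sets that is invariant under isomorphism and additive on disjoint unions
extends linearly to `kB(G)`. -/
def lift {M : Type 1} [AddCommGroup M] [Module k M] (f : FinGSet G → M)
    (hiso : ∀ X Y : FinGSet G, X.Iso Y → f X = f Y)
    (hadd : ∀ X Y : FinGSet G, f (X.disjUnion Y) = f X + f Y) : Burnside k G →ₗ[k] M :=
  Submodule.liftQ _ (Finsupp.linearCombination k f) (by
    rw [Submodule.span_le]
    rintro v (⟨X, Y, h, rfl⟩ | ⟨X, Y, rfl⟩)
    · simp [hiso X Y h]
    · simp [hadd X Y])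

@[simp]
theorem lift_cls {M : Type 1} [AddCommGroup M] [Module k M] (f : FinGSet G → M)
    (hiso : ∀ X Y : FinGSet G, X.Iso Y → f X = f Y)
    (hadd : ∀ X Y : FinGSet G, f (X.disjUnion Y) = f X + f Y) (X : FinGSet G) :
    lift (k := k) f hiso hadd (cls k X) = f X := by
  simp [lift, cls]

theorem hom_ext {M : Type 1} [AddCommGroup M] [Module k M] {f g : Burnside k G →ₗ[k] M}
    (h : ∀ X : FinGSet G, f (cls k X) = g (cls k X)) : f = g := by
  refine Submodule.linearMap_qext _ (Finsupp.lhom_ext' fun X => LinearMap.ext_ring ?_)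
  exact h X

end Burnside

/-! ### Bisets and their action on Burnside groups -/

/-- A finite `(H, G)`-biset, that is, a finite `H × Gᵒᵖ`-set. -/
abbrev FinBiset (H G : Type) [Group H] [Group G] : Type 1 := FinGSet (H × Gᵐᵒᵖ)

namespace FinBiset

variable {H G : Type} [Group H] [Group G]

/-- The left action `h · u`. -/
def lact (U : FinBiset H G) (h : H) (u : U.carrier) : U.carrier :=
  ((h, 1) : H × Gᵐᵒᵖ) • u

/-- The right action `u · g`. -/
def ract (U : FinBiset H G) (u : U.carrier) (g : G) : U.carrier :=
  ((1, MulOpposite.op g) : H × Gᵐᵒᵖ) • u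

theorem ract_one (U : FinBiset H G) (u : U.carrier) : U.ract u 1 = u :=
  one_smul (H × Gᵐᵒᵖ) u

theorem ract_mul (U : FinBiset H G) (u : U.carrier) (a b : G) :
    U.ract u (a * b) = U.ract (U.ract u a) b := by
  simp [ract, smul_smul]

theorem lact_ract (U : FinBiset H G) (h : H) (u : U.carrier) (g : G) :
    U.lact h (U.ract u g) = U.ract (U.lact h u) g := by
  simp [lact, ract, smul_smul]

/-- The orbit relation on `U × X` of the right action `(u, x) g = (u g, g⁻¹ x)` of `G`. -/
def tensorSetoid (U : FinBiset H G) (X : FinGSet G) : Setoid (U.carrier × X.carrier) where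
  r a b := ∃ g : G, b = (U.ract a.1 g, g⁻¹ • a.2)
  iseqv :=
    { refl := fun a => ⟨1, by simp [ract_one]⟩
      symm := by
        rintro a b ⟨g, rfl⟩
        exact ⟨g⁻¹, by simp [← ract_mul, ract_one]⟩
      trans := by
        rintro a b c ⟨g, rfl⟩ ⟨g', rfl⟩
        exact ⟨g * g', by simp [ract_mul, smul_smul]⟩ }

instance tensorAction (U : FinBiset H G) (X : FinGSet G) :
    MulAction H (Quotient (tensorSetoid U X)) where
  smul h := Quotient.map' (fun a => (U.lact h a.1, a.2)) (by
    rintro a b ⟨g, rfl⟩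
    exact ⟨g, by simp [lact_ract]⟩)
  one_smul := by
    rintro ⟨a⟩
    exact congrArg (Quotient.mk (tensorSetoid U X))
      (Prod.ext (one_smul (H × Gᵐᵒᵖ) a.1) rfl)
  mul_smul := by
    rintro h h' ⟨a⟩
    refine congrArg (Quotient.mk (tensorSetoid U X)) (Prod.ext ?_ rfl)
    simp [lact, smul_smul]

/-- The `H`-set `U ×_G X = (U × X)/G`, with `h · [u, x] = [h u, x]`. -/
def tensor (U : FinBiset H G) (X : FinGSet G) : FinGSet H where
  carrier := Quotient (tensorSetoid U X)

theorem tensor_iso_right (U : FinBiset H G) {X Y : FinGSet G} (h : X.Iso Y) :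
    (tensor U X).Iso (tensor U Y) := by
  obtain ⟨e, he⟩ := h
  refine ⟨Quotient.congr ((Equiv.refl _).prodCongr e) ?_, ?_⟩
  · rintro ⟨u, x⟩ ⟨v, y⟩
    refine exists_congr fun g => ?_
    simp [Prod.ext_iff, ← he]
  · rintro h ⟨a⟩
    rfl

theorem tensor_iso_left {U V : FinBiset H G} (h : U.Iso V) (X : FinGSet G) :
    (tensor U X).Iso (tensor V X) := by
  obtain ⟨e, he⟩ := h
  refine ⟨Quotient.congr (e.prodCongr (Equiv.refl _)) ?_, ?_⟩
  · rintro ⟨u, x⟩ ⟨v, y⟩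
    refine exists_congr fun g => ?_
    simp [Prod.ext_iff, ract, ← he]
  · rintro h ⟨a⟩
    exact congrArg (Quotient.mk (tensorSetoid V X)) (Prod.ext (he _ _) rfl)

theorem tensor_disjUnion_right (U : FinBiset H G) (X Y : FinGSet G) :
    (tensor U (X.disjUnion Y)).Iso ((tensor U X).disjUnion (tensor U Y)) := by
  refine ⟨⟨Quotient.lift (s := tensorSetoid U (X.disjUnion Y))
      (fun a => match a with
        | (u, Sum.inl x) => Sum.inl (Quotient.mk (tensorSetoid U X) (u, x))
        | (u, Sum.inr y) => Sum.inr (Quotient.mk (tensorSetoid U Y) (u, y))) ?_,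
      Sum.elim
        (Quotient.lift (s := tensorSetoid U X) (fun a =>
          Quotient.mk (tensorSetoid U (X.disjUnion Y)) (a.1, Sum.inl a.2)) ?_)
        (Quotient.lift (s := tensorSetoid U Y) (fun a =>
          Quotient.mk (tensorSetoid U (X.disjUnion Y)) (a.1, Sum.inr a.2)) ?_), ?_, ?_⟩, ?_⟩
  · rintro ⟨u, x | x⟩ _ ⟨g, rfl⟩
    · exact congrArg Sum.inl (Quotient.sound ⟨g, rfl⟩)
    · exact congrArg Sum.inr (Quotient.sound ⟨g, rfl⟩)
  · rintro a _ ⟨g, rfl⟩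
    exact Quotient.sound ⟨g, rfl⟩
  · rintro a _ ⟨g, rfl⟩
    exact Quotient.sound ⟨g, rfl⟩
  · rintro ⟨u, x | x⟩ <;> rfl
  · rintro (a | a) <;> exact Quotient.inductionOn a fun _ => rfl
  · rintro h ⟨u, x | x⟩ <;> rfl

theorem tensor_disjUnion_left (U V : FinBiset H G) (X : FinGSet G) :
    (tensor (FinGSet.disjUnion U V) X).Iso ((tensor U X).disjUnion (tensor V X)) := by
  refine ⟨⟨Quotient.lift (s := tensorSetoid (FinGSet.disjUnion U V) X)
      (fun a => match a with
        | (Sum.inl u, x) => Sum.inl (Quotient.mk (tensorSetoid U X) (u, x))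
        | (Sum.inr v, x) => Sum.inr (Quotient.mk (tensorSetoid V X) (v, x))) ?_,
      Sum.elim
        (Quotient.lift (s := tensorSetoid U X) (fun a =>
          Quotient.mk (tensorSetoid (FinGSet.disjUnion U V) X) (Sum.inl a.1, a.2)) ?_)
        (Quotient.lift (s := tensorSetoid V X) (fun a =>
          Quotient.mk (tensorSetoid (FinGSet.disjUnion U V) X) (Sum.inr a.1, a.2)) ?_), ?_, ?_⟩, ?_⟩
  · rintro ⟨u | u, x⟩ _ ⟨g, rfl⟩
    · exact congrArg Sum.inl (Quotient.sound ⟨g, rfl⟩)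
    · exact congrArg Sum.inr (Quotient.sound ⟨g, rfl⟩)
  · rintro a _ ⟨g, rfl⟩
    exact Quotient.sound ⟨g, rfl⟩
  · rintro a _ ⟨g, rfl⟩
    exact Quotient.sound ⟨g, rfl⟩
  · rintro ⟨u | u, x⟩ <;> rfl
  · rintro (a | a) <;> exact Quotient.inductionOn a fun _ => rfl
  · rintro h ⟨u | u, x⟩ <;> rfl

end FinBiset

/-- The action of `kB(H, G) = kB(H × Gᵒᵖ)` on `kB(G)`, with values in `kB(H)`: the bilinear map
with `([U], [X]) ↦ [U ×_G X]`. Thus `bisetMap α` is the value `kB(α) : kB(G) → kB(H)` of the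
Burnside biset functor `kB` at the morphism `α` from `G` to `H`. -/
def bisetMap {k : Type} [CommRing k] {H G : Type} [Group H] [Group G] :
    Burnside k (H × Gᵐᵒᵖ) →ₗ[k] Burnside k G →ₗ[k] Burnside k H :=
  Burnside.lift
    (fun U => Burnside.lift (fun X => Burnside.cls k (FinBiset.tensor U X))
      (fun _ _ h => Burnside.cls_eq_of_iso (FinBiset.tensor_iso_right U h))
      (fun X Y => (Burnside.cls_eq_of_iso (FinBiset.tensor_disjUnion_right U X Y)).trans
        (Burnside.cls_disjUnion _ _)))
    (fun _ _ h => Burnside.hom_ext fun X => by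
      simpa using Burnside.cls_eq_of_iso (FinBiset.tensor_iso_left h X))
    (fun U V => Burnside.hom_ext fun X => by
      simpa using (Burnside.cls_eq_of_iso (FinBiset.tensor_disjUnion_left U V X)).trans
        (Burnside.cls_disjUnion _ _))

theorem bisetMap_cls {k : Type} [CommRing k] {H G : Type} [Group H] [Group G]
    (U : FinBiset H G) (X : FinGSet G) :
    bisetMap (Burnside.cls k U) (Burnside.cls k X) = Burnside.cls k (FinBiset.tensor U X) := by
  simp [bisetMap]

/-! ### Subfunctors of the Burnside biset functor -/

/-- A biset subfunctor of `kB`: for each finite group `G` a submodule of `kB(G)`, stable under all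
the maps `kB(α) : kB(G) → kB(H)` for `α ∈ kB(H, G)`. -/
@[ext]
structure BurnsideSubfunctor (k : Type) [CommRing k] : Type 1 where
  obj : ∀ G : FiniteGrp.{0}, Submodule k (Burnside k G)
  map_mem : ∀ (G H : FiniteGrp.{0}) (α : Burnside k (H × (G : Type)ᵐᵒᵖ)),
    ∀ v ∈ obj G, bisetMap α v ∈ obj H

namespace BurnsideSubfunctor

variable {k : Type} [CommRing k]

/-- Subfunctors are ordered by inclusion. -/
instance : PartialOrder (BurnsideSubfunctor k) :=
  PartialOrder.lift obj fun _ _ h => BurnsideSubfunctor.ext h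

/-- An element of `kB`: a pair `(R, v)` of a finite group `R` and `v ∈ kB(R)`. -/
abbrev Element (k : Type) [CommRing k] : Type 1 := Σ R : FiniteGrp.{0}, Burnside k R

/-- The subfunctor `⟨𝒢⟩` generated by a set `𝒢` of elements: the intersection of all the
subfunctors `M` with `v ∈ M(R)` for all `(R, v) ∈ 𝒢`. -/
def generated (𝒢 : Set (Element k)) : BurnsideSubfunctor k where
  obj G := ⨅ M : {M : BurnsideSubfunctor k // ∀ x ∈ 𝒢, x.2 ∈ M.obj x.1}, M.1.obj G
  map_mem G H α v hv := by
    rw [Submodule.mem_iInf] at hv ⊢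
    exact fun M => M.1.map_mem G H α v (hv M)

/-- `𝒢` generates the subfunctor `M`, and no proper subset of `𝒢` does. -/
def IsMinimalGeneratingSet (𝒢 : Set (Element k)) (M : BurnsideSubfunctor k) : Prop :=
  generated 𝒢 = M ∧ ∀ 𝒢' : Set (Element k), 𝒢' ⊂ 𝒢 → generated 𝒢' ≠ M

end BurnsideSubfunctor

/-! ### The groups and the generators -/

/-- `R` is a semidihedral group of order `2 ^ n` (meant for `n ≥ 4`):
`R = ⟨a, b⟩` with `a` of order `2 ^ (n - 1)`, `b` of order `2` and
`b a b⁻¹ = a ^ (2 ^ (n - 2) - 1)`. -/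
def IsSemidihedral (n : ℕ) (R : Type) [Group R] : Prop :=
  Nat.card R = 2 ^ n ∧ ∃ a b : R, orderOf a = 2 ^ (n - 1) ∧ orderOf b = 2 ∧
    b * a * b⁻¹ = a ^ (2 ^ (n - 2) - 1) ∧ Subgroup.closure {a, b} = ⊤

/-- `S` consists of exactly one group of order `p` for each odd prime `p`, exactly one cyclic group
of order `4`, and exactly one semidihedral group of order `2 ^ n` for each `n ≥ 4`. -/
structure IsFamilyS (S : Set FiniteGrp.{0}) : Prop where
  mem_type : ∀ R ∈ S, ((Nat.card R).Prime ∧ Odd (Nat.card R)) ∨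
    (IsCyclic R ∧ Nat.card R = 4) ∨ ∃ n : ℕ, 4 ≤ n ∧ IsSemidihedral n R
  prime : ∀ p : ℕ, p.Prime → Odd p → ∃! R : FiniteGrp.{0}, R ∈ S ∧ Nat.card R = p
  four : ∃! R : FiniteGrp.{0}, R ∈ S ∧ IsCyclic R ∧ Nat.card R = 4
  semidihedral : ∀ n : ℕ, 4 ≤ n → ∃! R : FiniteGrp.{0}, R ∈ S ∧ IsSemidihedral n R

/-- The possible expressions of the element `ε_R` of `kB(R)`, for `R` of odd prime order, cyclic of
order `4`, or semidihedral of order at least `16`. The subgroup `T` below is the only one of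
order `2`, and the subgroups `I` below are all conjugate, so `ε_R` is unique. -/
inductive IsEpsilon (k : Type) [CommRing k] (R : Type) [Group R] [Finite R] :
    Burnside k R → Prop
  | prime (hp : (Nat.card R).Prime) (hodd : Odd (Nat.card R)) :
      IsEpsilon k R (Burnside.cls k (FinGSet.coset R ⊥) - Burnside.cls k (FinGSet.coset R ⊤))
  | four (hc : IsCyclic R) (h4 : Nat.card R = 4) (T : Subgroup R) (hT : Nat.card T = 2) :
      IsEpsilon k R (Burnside.cls k (FinGSet.coset R ⊥) - Burnside.cls k (FinGSet.coset R T))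
  | semidihedral (n : ℕ) (hn : 4 ≤ n) (hR : IsSemidihedral n R)
      (I : Subgroup R) (hI : Nat.card I = 2) (hIZ : ¬ I ≤ Subgroup.center R) :
      IsEpsilon k R (Burnside.cls k (FinGSet.coset R I) -
        Burnside.cls k (FinGSet.coset R (I ⊔ Subgroup.center R)))

open Classical in
/-- The element `ε_R ∈ kB(R)` (and `0` for the groups `R` not listed in `IsEpsilon`). For
`k = 𝔽₂` it is the reduction modulo `2` of the element `ε_R` of `B(R)`. -/
def epsilon (k : Type) [CommRing k] (R : Type) [Group R] [Finite R] : Burnside k R :=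
  if h : ∃ v, IsEpsilon k R v then h.choose else 0

/-- `𝒢_S = {(R, ε̄_R) | R ∈ S}`, a set of elements of `𝔽₂B`. -/
def generators (S : Set FiniteGrp.{0}) : Set (BurnsideSubfunctor.Element (ZMod 2)) :=
  {x | ∃ R ∈ S, x = ⟨R, epsilon (ZMod 2) R⟩}

/-- The subfunctor `L` of `𝔽₂B`: the one generated by `𝒢_S`. -/
def subfunctorL (S : Set FiniteGrp.{0}) : BurnsideSubfunctor (ZMod 2) :=
  BurnsideSubfunctor.generated (generators S)

end BisetTheory

end

/-! It suffices that no generator `ε_R` lies in the subfunctor generated by the others, and this is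
shown by exhibiting, for each `R` in `S`, an invariant that sees `ε_R` and nothing else. Each such
`R` has a cyclic subgroup `⟨a⟩` and a central element `z` lying in every nontrivial subgroup of
`⟨a⟩`: all of `R` for odd prime order or order 4, the maximal cyclic subgroup for a semidihedral
group. The invariant `freeOrbitParity` counts modulo 2 the free `⟨a⟩`-orbits of an `R`-set, which
together consist of the points moved by `z`. It equals 1 on `ε_R`. The elements killed by the
invariant after applying any biset with values in `R` form a subfunctor (`detected`), so everything
reduces to putting `ε_{R'}` in it for `R' ≠ R` (`IsEpsilon.mem_detected`).

Let `U` be an `(R, R')`-biset, and `z'` the distinguished element of `R'`. Orbit counting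
(`card_mul_moved_tensor`) expresses the change in the number of moved points in terms of D =
fix(1,1) - fix(z,1) - fix(1,z') + fix(z,z'), with fixed points taken on `U`: the change is (q-1)D/q,
D/2 or D/4 according as `R'` has odd prime order q, is cyclic of order 4, or is semidihedral. The
change must be divisible by twice the order of `a`. Now D is the sum over `U` of a weight depending
only on the point stabilizer, so it can be estimated orbit by orbit, as weight times index.

If `a` and `a'` have coprime orders, the product of these orders divides D
(`orderOf_mul_orderOf_dvd_of_coprime`). For two 2-groups the essential bound is
`IsTwoCore.card_dvd_of_left_right_notMem`: a stabilizer avoiding `(z,1)` and `(1,z')` is small,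
because semidihedral actions on cyclic groups of different orders are incompatible. -/

noncomputable section
namespace BisetTheory

/-! ### Composition of bisets and the subfunctor detected by a linear form -/

namespace FinBiset

variable {K H G : Type} [Group K] [Group H] [Group G]

/-- The orbit relation on `V × U` of the right action `(v, u) h = (v h, h⁻¹ u)` of `H`. -/
def compSetoid (V : FinBiset K H) (U : FinBiset H G) : Setoid (V.carrier × U.carrier) where
  r a b := ∃ h : H, b = (V.ract a.1 h, U.lact h⁻¹ a.2)
  iseqv :=
    { refl := fun a => ⟨1, by simp [ract_one, lact, ← Prod.one_eq_mk]⟩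
      symm := by
        rintro a b ⟨h, rfl⟩
        exact ⟨h⁻¹, by simp [← ract_mul, ract_one, lact, smul_smul, ← Prod.one_eq_mk]⟩
      trans := by
        rintro a b c ⟨h, rfl⟩ ⟨h', rfl⟩
        exact ⟨h * h', by simp [ract_mul, lact, smul_smul]⟩ }

instance compAction (V : FinBiset K H) (U : FinBiset H G) :
    MulAction (K × Gᵐᵒᵖ) (Quotient (compSetoid V U)) where
  smul x := Quotient.map' (fun a => (V.lact x.1 a.1, U.ract a.2 x.2.unop)) (by
    rintro a b ⟨h, rfl⟩
    exact ⟨h, by simp [lact_ract]⟩)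
  one_smul := by
    rintro ⟨a⟩
    exact congrArg (Quotient.mk (compSetoid V U))
      (Prod.ext (one_smul (K × Hᵐᵒᵖ) a.1) (one_smul (H × Gᵐᵒᵖ) a.2))
  mul_smul := by
    rintro x y ⟨a⟩
    refine congrArg (Quotient.mk (compSetoid V U)) (Prod.ext ?_ ?_)
    · simp [lact, smul_smul]
    · simp [ract, smul_smul]

/-- The `(K, G)`-biset `V ×_H U`. -/
def comp (V : FinBiset K H) (U : FinBiset H G) : FinBiset K G where
  carrier := Quotient (compSetoid V U)

theorem lact_one (U : FinBiset H G) (u : U.carrier) : U.lact 1 u = u :=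
  one_smul (H × Gᵐᵒᵖ) u

/-- Both sides are quotients of triples `(v, u, x)`. This associativity is what makes `detected`
stable under bisets. -/
theorem tensor_comp (V : FinBiset K H) (U : FinBiset H G) (X : FinGSet G) :
    (tensor V (tensor U X)).Iso (tensor (comp V U) X) := by
  have key (v : V.carrier) (u : U.carrier) (x : X.carrier) (g : G) :
      Quotient.mk (tensorSetoid (comp V U) X)
          (Quotient.mk (compSetoid V U) (v, U.ract u g), g⁻¹ • x) =
        Quotient.mk (tensorSetoid (comp V U) X) (Quotient.mk (compSetoid V U) (v, u), x) := by
    symm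
    refine Quotient.sound (s := tensorSetoid (comp V U) X) ⟨g, Prod.ext ?_ rfl⟩
    exact congrArg (Quotient.mk (compSetoid V U)) (Prod.ext (lact_one V v).symm rfl)
  have key' (v : V.carrier) (u : U.carrier) (x : X.carrier) (h : H) :
      Quotient.mk (tensorSetoid V (tensor U X))
          (V.ract v h, Quotient.mk (tensorSetoid U X) (U.lact h⁻¹ u, x)) =
        Quotient.mk (tensorSetoid V (tensor U X)) (v, Quotient.mk (tensorSetoid U X) (u, x)) := by
    symm
    exact Quotient.sound (s := tensorSetoid V (tensor U X)) ⟨h, rfl⟩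
  let f : (tensor V (tensor U X)).carrier → (tensor (comp V U) X).carrier :=
    Quotient.lift (s := tensorSetoid V (tensor U X))
      (fun a => Quotient.lift (s := tensorSetoid U X)
        (fun b => Quotient.mk (tensorSetoid (comp V U) X)
          (Quotient.mk (compSetoid V U) (a.1, b.1), b.2))
        (by rintro ⟨u, x⟩ _ ⟨g, rfl⟩; exact (key _ _ _ _).symm) a.2)
      (by
        rintro ⟨v, ⟨u, x⟩⟩ _ ⟨h, rfl⟩
        refine congrArg (Quotient.mk (tensorSetoid (comp V U) X)) (Prod.ext ?_ rfl)
        exact Quotient.sound ⟨h, rfl⟩)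
  let g : (tensor (comp V U) X).carrier → (tensor V (tensor U X)).carrier :=
    Quotient.lift (s := tensorSetoid (comp V U) X)
      (fun a => Quotient.lift (s := compSetoid V U)
        (fun b => Quotient.mk (tensorSetoid V (tensor U X))
          (b.1, Quotient.mk (tensorSetoid U X) (b.2, a.2)))
        (by rintro ⟨v, u⟩ _ ⟨h, rfl⟩; exact (key' _ _ _ _).symm) a.1)
      (by
        rintro ⟨⟨v, u⟩, x⟩ _ ⟨g, rfl⟩
        refine congrArg (Quotient.mk (tensorSetoid V (tensor U X)))
          (Prod.ext (lact_one V v).symm ?_)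
        exact Quotient.sound ⟨g, rfl⟩)
  refine ⟨⟨f, g, ?_, ?_⟩, ?_⟩
  · rintro ⟨v, ⟨u, x⟩⟩; rfl
  · rintro ⟨⟨v, u⟩, x⟩; rfl
  · rintro k ⟨v, ⟨u, x⟩⟩
    refine congrArg (Quotient.mk (tensorSetoid (comp V U) X)) (Prod.ext ?_ rfl)
    exact congrArg (Quotient.mk (compSetoid V U)) (Prod.ext rfl (ract_one U u).symm)

/-- The identity biset `G`, with `G` acting by left and right multiplication. -/
def identity (G : Type) [Group G] [Finite G] : FinBiset G G where
  carrier := G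
  action :=
    { smul := fun x u => x.1 * u * x.2.unop
      one_smul := fun u => by change 1 * u * 1 = u; simp
      mul_smul := fun x y u => by
        change (x.1 * y.1) * u * (y.2.unop * x.2.unop) = x.1 * (y.1 * u * y.2.unop) * x.2.unop
        group }

theorem tensor_identity [Finite G] (X : FinGSet G) : (tensor (identity G) X).Iso X := by
  let ι : (identity G).carrier → G := id
  have hl (g : G) (u : (identity G).carrier) : ι ((identity G).lact g u) = g * ι u :=
    mul_one (g * ι u)
  have hr (g : G) (u : (identity G).carrier) : ι ((identity G).ract u g) = ι u * g :=
    congrArg (· * g) (one_mul (ι u))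
  let f : (tensor (identity G) X).carrier → X.carrier :=
    Quotient.lift (s := tensorSetoid (identity G) X) (fun a => ι a.1 • a.2) (by
      rintro ⟨u, x⟩ _ ⟨g, rfl⟩
      change ι u • x = ι ((identity G).ract u g) • g⁻¹ • x
      rw [hr, smul_smul, mul_inv_cancel_right])
  refine ⟨⟨f, fun x => Quotient.mk (tensorSetoid (identity G) X) ((1 : G), x), ?_, ?_⟩, ?_⟩
  · rintro ⟨u, x⟩
    refine Quotient.sound (s := tensorSetoid (identity G) X) ⟨ι u, Prod.ext ?_ ?_⟩
    · exact ((hr _ _).trans (one_mul (ι u))).symm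
    · exact (inv_smul_smul (ι u) x).symm
  · intro x
    exact one_smul G x
  · rintro g ⟨u, x⟩
    change ι ((identity G).lact g u) • x = g • ι u • x
    rw [hl, smul_smul]

end FinBiset

theorem bisetMap_comp {k : Type} [CommRing k] {K H G : Type} [Group K] [Group H] [Group G]
    (V : FinBiset K H) (U : FinBiset H G) (v : Burnside k G) :
    bisetMap (Burnside.cls k V) (bisetMap (Burnside.cls k U) v) =
      bisetMap (Burnside.cls k (V.comp U)) v := by
  suffices h : (bisetMap (Burnside.cls k V)).comp (bisetMap (Burnside.cls k U)) =
      bisetMap (Burnside.cls k (V.comp U)) from LinearMap.congr_fun h v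
  refine Burnside.hom_ext fun X => ?_
  rw [LinearMap.comp_apply, bisetMap_cls, bisetMap_cls, bisetMap_cls]
  exact Burnside.cls_eq_of_iso (FinBiset.tensor_comp V U X)

theorem bisetMap_identity {k : Type} [CommRing k] {G : Type} [Group G] [Finite G]
    (v : Burnside k G) : bisetMap (Burnside.cls k (FinBiset.identity G)) v = v := by
  suffices h : bisetMap (Burnside.cls k (FinBiset.identity G)) = LinearMap.id from
    LinearMap.congr_fun h v
  refine Burnside.hom_ext fun X => ?_
  rw [bisetMap_cls]
  exact Burnside.cls_eq_of_iso (FinBiset.tensor_identity X)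

namespace BurnsideSubfunctor

variable {k : Type} [CommRing k]

/-- The largest subfunctor of `kB` whose value at `R` is contained in the kernel of the linear
form `f`. -/
def detected {R : Type} [Group R] {M : Type 1} [AddCommGroup M] [Module k M]
    (f : Burnside k R →ₗ[k] M) : BurnsideSubfunctor k where
  obj G := ⨅ U : FinBiset R G, LinearMap.ker (f ∘ₗ bisetMap (Burnside.cls k U))
  map_mem G H α v hv := by
    simp only [Submodule.mem_iInf, LinearMap.mem_ker, LinearMap.comp_apply] at hv ⊢
    intro V
    -- Linearity in `α` reduces to the class of a single biset `U`, and `V` after `U` is again one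
    -- of the bisets tested.
    suffices h : (f ∘ₗ bisetMap (Burnside.cls k V)) ∘ₗ (bisetMap (k := k)).flip v =
        (0 : Burnside k (H × (G : Type)ᵐᵒᵖ) →ₗ[k] M) from LinearMap.congr_fun h α
    refine Burnside.hom_ext fun U => ?_
    simpa [bisetMap_comp] using hv (V.comp U)

theorem mem_detected {R : Type} [Group R] {M : Type 1} [AddCommGroup M] [Module k M]
    {f : Burnside k R →ₗ[k] M} {G : FiniteGrp.{0}} {v : Burnside k G} :
    v ∈ (detected f).obj G ↔ ∀ U : FinBiset R G, f (bisetMap (Burnside.cls k U) v) = 0 := by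
  simp [detected]

theorem apply_eq_zero_of_mem_detected {R : FiniteGrp.{0}} {M : Type 1} [AddCommGroup M]
    [Module k M] {f : Burnside k R →ₗ[k] M} {v : Burnside k R} (h : v ∈ (detected f).obj R) :
    f v = 0 := by
  simpa [bisetMap_identity] using mem_detected.1 h (FinBiset.identity R)

theorem mem_generated {𝒢 : Set (Element k)} {x : Element k} (hx : x ∈ 𝒢) :
    x.2 ∈ (generated 𝒢).obj x.1 := by
  simp only [generated, Submodule.mem_iInf]
  exact fun M => M.2 x hx

theorem generated_le {𝒢 : Set (Element k)} {M : BurnsideSubfunctor k}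
    (h : ∀ x ∈ 𝒢, x.2 ∈ M.obj x.1) : generated 𝒢 ≤ M :=
  fun _ => iInf_le_of_le ⟨M, h⟩ le_rfl

end BurnsideSubfunctor

/-! ### Counting fixed points -/

section Counting

variable {Γ : Type} [Group Γ] {U : Type} [MulAction Γ U]

/-- The weight is constant on each orbit, and the orbit of `u` has as many points as the index of
its stabilizer. -/
theorem dvd_sum_of_dvd_mul_index [Fintype U] {d : ℤ} (w : U → ℤ)
    (hw : ∀ (g : Γ) (u : U), w (g • u) = w u)
    (h : ∀ u, d ∣ w u * ((MulAction.stabilizer Γ u).index : ℤ)) : d ∣ ∑ u, w u := by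
  classical
  let p : U → MulAction.orbitRel.Quotient Γ U := Quotient.mk''
  rw [← Finset.sum_fiberwise (s := Finset.univ) (g := p)]
  refine Finset.dvd_sum fun q _ => ?_
  induction q using Quotient.inductionOn' with
  | h u =>
    have hmem (v : U) : p v = p u ↔ v ∈ MulAction.orbit Γ u := by
      rw [← MulAction.orbitRel_apply]
      exact Quotient.eq''
    have hconst : ∀ v ∈ Finset.univ.filter (fun v => p v = p u), w v = w u := by
      intro v hv
      obtain ⟨g, rfl⟩ := (hmem v).1 (Finset.mem_filter.1 hv).2
      exact hw g u
    change d ∣ ∑ v with p v = p u, w v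
    rw [Finset.sum_congr rfl hconst, Finset.sum_const, nsmul_eq_mul, mul_comm]
    suffices hc : (Finset.univ.filter (fun v => p v = p u)).card =
        (MulAction.stabilizer Γ u).index by
      rw [hc]
      exact h u
    rw [MulAction.index_stabilizer, ← Set.ncard_coe_finset]
    congr 1
    ext v
    simp [hmem]

/-- The number of fixed points of `γ`. -/
def fixCard (U : Type) [MulAction Γ U] (γ : Γ) : ℤ := Nat.card {u : U // γ • u = u}

theorem fixCard_eq_sum [Fintype U] [DecidableEq U] (γ : Γ) :
    fixCard U γ = ∑ u : U, if γ • u = u then 1 else 0 := by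
  simp [fixCard, Nat.card_eq_fintype_card, Fintype.card_subtype]

theorem fixCard_conj (g γ : Γ) : fixCard U (g * γ * g⁻¹) = fixCard U γ := by
  refine congrArg Nat.cast (Nat.card_congr ((MulAction.toPerm g).subtypeEquiv fun u => ?_)).symm
  simp only [MulAction.toPerm_apply, mul_smul, inv_smul_smul]
  exact (smul_left_cancel_iff g).symm

theorem fixCard_congr {γ δ : Γ} (h : ∀ u : U, γ • u = u ↔ δ • u = u) :
    fixCard U γ = fixCard U δ :=
  congrArg Nat.cast (Nat.card_congr (Equiv.subtypeEquivRight h))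

/-- A version of the orbit counting lemma: if `Q` is the set of orbits of `K` on `U`, and `σ` is
the permutation of `Q` induced by `ζ`, then the number of fixed points of `σ` is the average
number of fixed points of `k ζ`, for `k ∈ K`. -/
theorem card_mul_card_fixed_quotient [Finite U] (K : Subgroup Γ) [Fintype K] {Q : Type} [Finite Q]
    (p : U → Q) (hp : Function.Surjective p) (hpK : ∀ u v, p u = p v ↔ ∃ k : K, k • u = v)
    (ζ : Γ) (σ : Q → Q) (hσ : ∀ u, p (ζ • u) = σ (p u)) :
    (Nat.card K : ℤ) * Nat.card {q : Q // σ q = q} = ∑ k : K, fixCard U ((k : Γ) * ζ) := by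
  classical
  have := Fintype.ofFinite U
  have := Fintype.ofFinite Q
  simp_rw [fixCard_eq_sum]
  rw [Finset.sum_comm, ← Finset.sum_fiberwise (s := Finset.univ) (g := p)]
  -- Count pairs `(k, u)` with `kζu = u` over each `K`-orbit. If `ζ` preserves the orbit, the `k`
  -- for a given `u` form a coset of the stabilizer of `u`, so orbit–stabilizer gives `|K|` pairs;
  -- otherwise there are none.
  have hq (q : Q) : (∑ u with p u = q, ∑ k : K, if ((k : Γ) * ζ) • u = u then (1 : ℤ) else 0) =
      if σ q = q then (Nat.card K : ℤ) else 0 := by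
    obtain ⟨u₀, rfl⟩ := hp q
    split_ifs with hfix
    · have hconst : ∀ u ∈ Finset.univ.filter (fun u => p u = p u₀),
          (∑ k : K, if ((k : Γ) * ζ) • u = u then (1 : ℤ) else 0) =
            Nat.card (MulAction.stabilizer K u₀) := by
        intro u hu
        obtain ⟨l, hl⟩ := (hpK _ _).1 (Finset.mem_filter.1 hu).2.symm
        obtain ⟨m, hm⟩ := (hpK (ζ • u) u).1 (by
          rw [hσ, (Finset.mem_filter.1 hu).2, hfix])
        rw [Finset.sum_boole, ← Fintype.card_subtype, ← Nat.card_eq_fintype_card]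
        refine congrArg _ (Nat.card_congr
          { toFun := fun k => ⟨l⁻¹ * (k.1 * m⁻¹) * l, ?_⟩
            invFun := fun s => ⟨l * s.1 * l⁻¹ * m, ?_⟩
            left_inv := fun k => ?_
            right_inv := fun s => ?_ })
        · have hk := k.2
          rw [mul_smul] at hk
          rw [MulAction.mem_stabilizer_iff, mul_smul, hl, mul_smul, mul_smul,
            inv_smul_eq_iff.2 hm.symm, inv_smul_eq_iff, hl]
          exact hk
        · have hs := MulAction.mem_stabilizer_iff.1 s.2
          rw [mul_smul]
          change (l * s.1 * l⁻¹ * m) • ζ • u = u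
          rw [mul_smul, hm, mul_smul, mul_smul, inv_smul_eq_iff.2 hl.symm, hs, hl]
        · ext; simp [mul_assoc]
        · ext; simp [mul_assoc]
      rw [Finset.sum_congr rfl hconst, Finset.sum_const, nsmul_eq_mul]
      norm_cast
      rw [← Subgroup.card_mul_index (MulAction.stabilizer K u₀), MulAction.index_stabilizer,
        mul_comm, ← Set.ncard_coe_finset]
      congr 2
      ext u
      simp only [Finset.coe_filter, Finset.mem_univ, true_and, Set.mem_ofPred_eq]
      rw [eq_comm, hpK]
      rfl
    · refine Finset.sum_eq_zero fun u hu => Finset.sum_eq_zero fun k _ => if_neg fun hk => hfix ?_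
      rw [← (Finset.mem_filter.1 hu).2, ← hσ, hpK]
      exact ⟨k, by rwa [mul_smul] at hk⟩
  rw [Finset.sum_congr rfl fun q _ => hq q, ← Finset.sum_filter, Finset.sum_const, nsmul_eq_mul,
    mul_comm, Nat.card_eq_fintype_card, Fintype.card_subtype]

end Counting

/-! ### Points moved by a fixed group element -/

variable {R : Type} [Group R]

/-- The number of points of `X` that are not fixed by `z`. -/
def moved (z : R) (X : FinGSet R) : ℕ := Nat.card {x : X.carrier // z • x ≠ x}

theorem moved_eq_of_iso (z : R) {X Y : FinGSet R} (h : X.Iso Y) : moved z X = moved z Y := by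
  obtain ⟨e, he⟩ := h
  exact Nat.card_congr (e.subtypeEquiv fun x => by rw [← he, e.injective.ne_iff])

theorem moved_disjUnion (z : R) (X Y : FinGSet R) :
    moved z (X.disjUnion Y) = moved z X + moved z Y := by
  have hl (x : X.carrier) :
      (z • (Sum.inl x : (X.disjUnion Y).carrier) ≠ Sum.inl x) ↔ z • x ≠ x :=
    Sum.inl_injective.ne_iff (x := z • x)
  have hr (y : Y.carrier) :
      (z • (Sum.inr y : (X.disjUnion Y).carrier) ≠ Sum.inr y) ↔ z • y ≠ y :=
    Sum.inr_injective.ne_iff (x := z • y)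
  rw [moved, moved, moved, ← Nat.card_sum]
  refine Nat.card_congr ((Equiv.subtypeSum (α := X.carrier) (β := Y.carrier)).trans
    (Equiv.sumCongr (Equiv.subtypeEquivRight hl) (Equiv.subtypeEquivRight hr)))

theorem moved_eq_sub (z : R) (X : FinGSet R) :
    (moved z X : ℤ) = Nat.card X.carrier - fixCard X.carrier z := by
  classical
  have := Fintype.ofFinite X.carrier
  rw [moved, fixCard, eq_sub_iff_add_eq]
  norm_cast
  rw [add_comm, ← Nat.card_sum]
  exact Nat.card_congr (Equiv.sumCompl fun x : X.carrier => z • x = x)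

theorem card_mul_moved_tensor {R' : Type} [Group R'] [Finite R'] (z : R) (U : FinBiset R R')
    (H : Subgroup R') [Fintype H] :
    (Nat.card H : ℤ) * moved z (U.tensor (FinGSet.coset R' H)) =
      ∑ h : H, (fixCard U.carrier ((1, .op (h : R')) : R × R'ᵐᵒᵖ) -
        fixCard U.carrier ((z, .op (h : R')) : R × R'ᵐᵒᵖ)) := by
  classical
  -- `U ×_{R'} R'/H` is the orbit set `U/H`, so the twisted orbit count applies with `ζ = 1` and `ζ
  -- = z`.
  let K : Subgroup (R × R'ᵐᵒᵖ) := (⊥ : Subgroup R).prod H.op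
  let e : H ≃ K :=
    { toFun := fun h => ⟨(1, .op h), by simp [K, Subgroup.mem_prod]⟩
      invFun := fun k => ⟨k.1.2.unop, (Subgroup.mem_prod.1 k.2).2⟩
      left_inv := fun h => rfl
      right_inv := fun k => Subtype.ext (Prod.ext (Subgroup.mem_prod.1 k.2).1.symm rfl) }
  have : Fintype K := Fintype.ofEquiv H e
  let X := U.tensor (FinGSet.coset R' H)
  let p : U.carrier → X.carrier := fun u =>
    Quotient.mk (FinBiset.tensorSetoid U (FinGSet.coset R' H)) (u, ((1 : R') : R' ⧸ H))
  have hp : Function.Surjective p := by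
    rintro ⟨u, x⟩
    obtain ⟨g, rfl⟩ := QuotientGroup.mk_surjective (s := H) x
    refine ⟨U.ract u g, ?_⟩
    symm
    refine Quotient.sound (s := FinBiset.tensorSetoid U (FinGSet.coset R' H))
      ⟨g, Prod.ext rfl ?_⟩
    exact congrArg (QuotientGroup.mk (s := H)) (inv_mul_cancel g).symm
  have hpK (u v : U.carrier) : p u = p v ↔ ∃ k : K, k • u = v := by
    have : p u = p v ↔ ∃ g : R', (v, ((1 : R') : R' ⧸ H)) =
        (U.ract u g, ((g⁻¹ * 1 : R') : R' ⧸ H)) := Quotient.eq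
    rw [this]
    constructor
    · rintro ⟨g, hg⟩
      have hgH : g ∈ H := by
        have := QuotientGroup.eq.1 (Prod.ext_iff.1 hg).2
        simpa using this
      exact ⟨e ⟨g, hgH⟩, (Prod.ext_iff.1 hg).1.symm⟩
    · rintro ⟨k, rfl⟩
      obtain ⟨h, rfl⟩ := e.surjective k
      refine ⟨h, Prod.ext rfl (QuotientGroup.eq.2 ?_)⟩
      simp
  have key (ζ : R) : (Nat.card H : ℤ) * fixCard X.carrier ζ =
      ∑ h : H, fixCard U.carrier ((ζ, .op (h : R')) : R × R'ᵐᵒᵖ) := by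
    rw [Nat.card_congr e, fixCard, card_mul_card_fixed_quotient K p hp hpK ((ζ, 1) : R × R'ᵐᵒᵖ)
      (fun q => ζ • q) fun u => rfl, ← e.sum_comp]
    simp [e]
  have h1 : (Nat.card X.carrier : ℤ) = fixCard X.carrier (1 : R) := by
    rw [fixCard]
    simp
  rw [moved_eq_sub, h1, mul_sub, key, key, Finset.sum_sub_distrib]

theorem moved_coset_of_mem [Finite R] {z : R} (hz : ∀ g, Commute g z) {H : Subgroup R} (h : z ∈ H) :
    moved z (FinGSet.coset R H) = 0 := by
  rw [moved, Nat.card_eq_zero]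
  left
  constructor
  rintro ⟨x, hx⟩
  obtain ⟨g, rfl⟩ := QuotientGroup.mk_surjective (s := H) x
  refine hx (QuotientGroup.eq.2 ?_)
  simp [(hz g).eq.symm, H.inv_mem_iff, h]

theorem moved_coset_of_notMem [Finite R] {z : R} (hz : ∀ g, Commute g z) {H : Subgroup R}
    (h : z ∉ H) : moved z (FinGSet.coset R H) = H.index := by
  refine Nat.card_congr (Equiv.subtypeUnivEquiv fun x => ?_)
  obtain ⟨g, rfl⟩ := QuotientGroup.mk_surjective (s := H) x
  refine fun hx => h ?_
  have := QuotientGroup.eq.1 hx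
  simpa [(hz g).eq.symm, H.inv_mem_iff] using this

/-! ### Cyclic subgroups with a distinguished central element of prime order -/

/-- The central element `z` lies in every non-trivial subgroup of the cyclic group `⟨a⟩`. -/
structure IsCore {R : Type} [Group R] (a z : R) : Prop where
  mem : z ∈ Subgroup.zpowers a
  ne_one : z ≠ 1
  mem_zpowers : ∀ x ∈ Subgroup.zpowers a, x ≠ 1 → z ∈ Subgroup.zpowers x
  commute : ∀ g, Commute g z

open Classical in
/-- The value at `L` of `1 - [x ∈ L] - [y ∈ L] + [xy ∈ L]`. -/
def weight {Γ : Type} [Group Γ] (x y : Γ) (L : Subgroup Γ) : ℤ :=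
  1 - (if x ∈ L then 1 else 0) - (if y ∈ L then 1 else 0) + (if x * y ∈ L then 1 else 0)

section Weight

variable {Γ : Type} [Group Γ] {x y : Γ} {L : Subgroup Γ}

theorem weight_of_left_mem (h : x ∈ L) : weight x y L = 0 := by
  have hxy : x * y ∈ L ↔ y ∈ L := L.mul_mem_cancel_left h
  by_cases hy : y ∈ L <;> simp [weight, h, hy, hxy.2, mt hxy.1]

theorem weight_of_right_mem (h : y ∈ L) : weight x y L = 0 := by
  have hxy : x * y ∈ L ↔ x ∈ L := L.mul_mem_cancel_right h
  by_cases hx : x ∈ L <;> simp [weight, h, hx, hxy.2, mt hxy.1]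

theorem weight_of_notMem (hx : x ∉ L) (hy : y ∉ L) (hxy : x * y ∉ L) : weight x y L = 1 := by
  simp [weight, hx, hy, hxy]

theorem weight_of_mul_mem (hx : x ∉ L) (hy : y ∉ L) (hxy : x * y ∈ L) : weight x y L = 2 := by
  simp [weight, hx, hy, hxy]

theorem weight_congr {L' : Subgroup Γ} (hx : x ∈ L ↔ x ∈ L') (hy : y ∈ L ↔ y ∈ L')
    (hxy : x * y ∈ L ↔ x * y ∈ L') : weight x y L = weight x y L' := by
  classical
  unfold weight
  congr 1
  · congr 1
    · congr 1
      exact if_congr hx rfl rfl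
    · exact if_congr hy rfl rfl
  · exact if_congr hxy rfl rfl

variable {U : Type} [MulAction Γ U]

theorem sum_weight_stabilizer [Fintype U] :
    ∑ u : U, weight x y (MulAction.stabilizer Γ u) =
      fixCard U (1 : Γ) - fixCard U x - fixCard U y + fixCard U (x * y) := by
  classical
  simp only [fixCard_eq_sum, ← Finset.sum_sub_distrib, ← Finset.sum_add_distrib]
  refine Finset.sum_congr rfl fun u _ => ?_
  simp [weight, MulAction.mem_stabilizer_iff]

theorem weight_stabilizer_smul (hx : ∀ g, Commute g x) (hy : ∀ g, Commute g y) (g : Γ) (u : U) :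
    weight x y (MulAction.stabilizer Γ (g • u)) = weight x y (MulAction.stabilizer Γ u) := by
  have key {t : Γ} (ht : Commute g t) :
      t ∈ MulAction.stabilizer Γ (g • u) ↔ t ∈ MulAction.stabilizer Γ u := by
    rw [MulAction.mem_stabilizer_iff, MulAction.mem_stabilizer_iff, smul_smul, ← ht.eq, mul_smul,
      smul_left_cancel_iff]
  have hxg := key (hx g)
  have hyg := key (hy g)
  have hxyg := key ((hx g).mul_right (hy g))
  exact weight_congr hxg hyg hxyg

end Weight

theorem commute_of_mem_zpowers {G : Type} [Group G] {a x y : G} (hx : x ∈ Subgroup.zpowers a)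
    (hy : y ∈ Subgroup.zpowers a) : Commute x y := by
  obtain ⟨i, rfl⟩ := hx
  obtain ⟨j, rfl⟩ := hy
  exact (Commute.refl a).zpow_zpow i j

variable {R' : Type} [Group R']

theorem IsCore.eq_one_of_left_mem {a z : R} (h : IsCore a z) {L : Subgroup (R × R')}
    (hL : ((z, 1) : R × R') ∉ L) {x : R} (hx : x ∈ Subgroup.zpowers a)
    (hxL : ((x, 1) : R × R') ∈ L) : x = 1 := by
  by_contra hne
  obtain ⟨i, hi⟩ := h.mem_zpowers x hx hne
  refine hL ?_
  have := L.zpow_mem hxL i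
  simpa [← hi] using this

theorem IsCore.eq_one_of_right_mem {a z : R'} (h : IsCore a z) {L : Subgroup (R × R')}
    (hL : ((1, z) : R × R') ∉ L) {x : R'} (hx : x ∈ Subgroup.zpowers a)
    (hxL : ((1, x) : R × R') ∈ L) : x = 1 := by
  by_contra hne
  obtain ⟨i, hi⟩ := h.mem_zpowers x hx hne
  refine hL ?_
  have := L.zpow_mem hxL i
  simpa [← hi] using this

theorem IsCore.commute_left {a z : R} (h : IsCore a z) (g : R × R') :
    Commute g ((z, 1) : R × R') :=
  Prod.ext (h.commute g.1).eq (Commute.one_right g.2).eq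

theorem IsCore.commute_right {a z : R'} (h : IsCore a z) (g : R × R') :
    Commute g ((1, z) : R × R') :=
  Prod.ext (Commute.one_right g.1).eq (h.commute g.2).eq

/-- Only orbits of `⟨a⟩ × ⟨a'⟩` are needed. By coprimality a stabilizer there is a product of its
two factors; when it avoids both core elements it is trivial, and the orbit is regular. -/
theorem orderOf_mul_orderOf_dvd_of_coprime {a z : R} {a' z' : R'} (h : IsCore a z)
    (h' : IsCore a' z') (hc : (orderOf a).Coprime (orderOf a')) {U : Type} [MulAction (R × R') U]
    [Finite U] :
    ((orderOf a * orderOf a' : ℕ) : ℤ) ∣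
      fixCard U (1 : R × R') - fixCard U ((z, 1) : R × R') - fixCard U ((1, z') : R × R') +
        fixCard U ((z, z') : R × R') := by
  have := Fintype.ofFinite U
  have hzz : ((z, z') : R × R') = (z, 1) * (1, z') := by simp
  rw [hzz, ← sum_weight_stabilizer]
  let P : Subgroup (R × R') := (Subgroup.zpowers a).prod (Subgroup.zpowers a')
  refine dvd_sum_of_dvd_mul_index (Γ := P) _
    (fun g u => weight_stabilizer_smul h.commute_left h'.commute_right (g : R × R') u) fun u => ?_
  by_cases h1 : ((z, 1) : R × R') ∈ MulAction.stabilizer (R × R') u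
  · simp [weight_of_left_mem h1]
  by_cases h2 : ((1, z') : R × R') ∈ MulAction.stabilizer (R × R') u
  · simp [weight_of_right_mem h2]
  refine Dvd.dvd.mul_left ?_ _
  have hbot : MulAction.stabilizer P u = ⊥ := by
    rw [Subgroup.eq_bot_iff_forall]
    rintro ⟨⟨x, y⟩, hxy⟩ hs
    have hs' : ((x, y) : R × R') ∈ MulAction.stabilizer (R × R') u := hs
    obtain ⟨hx, hy⟩ := Subgroup.mem_prod.1 hxy
    have hxo : x ^ orderOf a = 1 :=
      orderOf_dvd_iff_pow_eq_one.1 (orderOf_dvd_of_mem_zpowers hx)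
    have hyo : y ^ orderOf a' = 1 :=
      orderOf_dvd_iff_pow_eq_one.1 (orderOf_dvd_of_mem_zpowers hy)
    -- Raising to the order of `a'` kills the second coordinate only, which isolates the first.
    have e1 : x ^ orderOf a' = 1 := by
      refine h.eq_one_of_left_mem h1 (Subgroup.pow_mem _ hx _) ?_
      have := Subgroup.pow_mem _ hs' (orderOf a')
      simpa [hyo] using this
    have e2 : y ^ orderOf a = 1 := by
      refine h'.eq_one_of_right_mem h2 (Subgroup.pow_mem _ hy _) ?_
      have := Subgroup.pow_mem _ hs' (orderOf a)
      simpa [hxo] using this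
    have hx1 : x = 1 := by
      rw [← orderOf_eq_one_iff]
      exact Nat.eq_one_of_dvd_coprimes hc (orderOf_dvd_of_pow_eq_one hxo)
        (orderOf_dvd_of_pow_eq_one e1)
    have hy1 : y = 1 := by
      rw [← orderOf_eq_one_iff]
      exact Nat.eq_one_of_dvd_coprimes hc (orderOf_dvd_of_pow_eq_one e2)
        (orderOf_dvd_of_pow_eq_one hyo)
    exact Subtype.ext (Prod.ext hx1 hy1)
  have hP : Nat.card P = orderOf a * orderOf a' := by
    rw [Nat.card_congr (Subgroup.prodEquiv _ _).toEquiv, Nat.card_prod, Nat.card_zpowers,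
      Nat.card_zpowers]
  rw [hbot, Subgroup.index_bot, hP]

/-! ### The case of `2`-groups -/

/-- A group of order `2 ^ (k + e)` with an element `a` of order `2 ^ k`, such that every element
outside of `⟨a⟩` acts on `⟨a⟩` as in a semidihedral group. For `e = 0` we ask for `k = 2`. -/
structure IsTwoCore {R : Type} [Group R] (k e : ℕ) (a : R) : Prop where
  orderOf_eq : orderOf a = 2 ^ k
  card_eq : Nat.card R = 2 ^ (k + e)
  le : e + 2 ≤ k
  eq_two : e = 0 → k = 2
  conj : ∀ g ∉ Subgroup.zpowers a, g * a * g⁻¹ = a ^ (2 ^ (k - 1) - 1)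

namespace IsTwoCore

variable {k e : ℕ} {a : R}

theorem conj_mem (h : IsTwoCore k e a) {g x : R} (hg : g ∉ Subgroup.zpowers a)
    (hx : x ∈ Subgroup.zpowers a) : g * x * g⁻¹ = x ^ (2 ^ (k - 1) - 1) := by
  obtain ⟨i, rfl⟩ := hx
  change g * a ^ i * g⁻¹ = _
  rw [← conj_zpow, h.conj g hg, ← zpow_natCast, ← zpow_natCast, zpow_comm]

theorem normal (h : IsTwoCore k e a) : (Subgroup.zpowers a).Normal := by
  refine ⟨fun x hx g => ?_⟩
  by_cases hg : g ∈ Subgroup.zpowers a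
  · exact Subgroup.mul_mem _ (Subgroup.mul_mem _ hg hx) (Subgroup.inv_mem _ hg)
  · rw [h.conj_mem hg hx]
    exact Subgroup.pow_mem _ hx _

theorem index_eq (h : IsTwoCore k e a) : (Subgroup.zpowers a).index = 2 ^ e := by
  have := (Subgroup.zpowers a).card_mul_index
  rw [Nat.card_zpowers, h.orderOf_eq, h.card_eq, pow_add] at this
  exact Nat.eq_of_mul_eq_mul_left (by positivity) this

theorem orderOf_pow (h : IsTwoCore k e a) : orderOf (a ^ 2 ^ (k - 1)) = 2 := by
  have hk : k = k - 1 + 1 := by have := h.le; omega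
  rw [orderOf_pow' _ (by positivity), h.orderOf_eq,
    Nat.gcd_eq_right (pow_dvd_pow 2 (Nat.sub_le k 1)), Nat.pow_div (Nat.sub_le k 1) two_pos]
  conv_lhs => rw [show k - (k - 1) = 1 by omega]
  exact pow_one 2

theorem pow_two_pow_sq (h : IsTwoCore k e a) : (a ^ 2 ^ (k - 1)) ^ 2 = 1 :=
  (congrArg _ h.orderOf_pow).symm.trans (pow_orderOf_eq_one (a ^ 2 ^ (k - 1)))

theorem eq_one_or_eq (h : IsTwoCore k e a) {x : R} (hx : x ∈ Subgroup.zpowers a)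
    (h2 : x ^ 2 = 1) : x = 1 ∨ x = a ^ 2 ^ (k - 1) := by
  obtain ⟨i, rfl⟩ := hx
  change (a ^ i) ^ 2 = 1 at h2
  change a ^ i = 1 ∨ a ^ i = _
  have hz := h.pow_two_pow_sq
  have hk : (2 : ℤ) ^ k = 2 ^ (k - 1) * 2 := by
    rw [← pow_succ, Nat.sub_add_cancel (by have := h.le; omega)]
  rw [← zpow_natCast, ← zpow_mul, ← orderOf_dvd_iff_zpow_eq_one, h.orderOf_eq] at h2
  push_cast at h2
  rw [hk] at h2
  obtain ⟨j, rfl⟩ := Int.dvd_of_mul_dvd_mul_right two_ne_zero h2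
  have hj : a ^ ((2 : ℤ) ^ (k - 1) * j) = (a ^ 2 ^ (k - 1)) ^ j := by
    rw [← zpow_natCast, ← zpow_mul]
    push_cast
    rfl
  rw [hj]
  rcases Int.even_or_odd' j with ⟨l, rfl | rfl⟩
  · left
    rw [zpow_mul, zpow_ofNat, hz, one_zpow]
  · right
    rw [zpow_add, zpow_mul, zpow_ofNat, hz, one_zpow, one_mul, zpow_one]

theorem eq_one_of_odd_pow (h : IsTwoCore k e a) {x : R} {m : ℕ} (hm : Odd m) (hx : x ^ m = 1) :
    x = 1 := by
  rw [← orderOf_eq_one_iff]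
  have h1 : orderOf x ∣ 2 ^ (k + e) := by
    rw [← h.card_eq]
    exact orderOf_dvd_natCard x
  refine Nat.eq_one_of_dvd_coprimes (Nat.Coprime.pow_left (k + e) ?_) h1
    (orderOf_dvd_of_pow_eq_one hx)
  exact Nat.coprime_two_left.2 hm

theorem isCore (h : IsTwoCore k e a) : IsCore a (a ^ 2 ^ (k - 1)) where
  mem := Subgroup.npow_mem_zpowers a _
  ne_one h1 := by
    have := h.orderOf_pow
    rw [h1] at this
    simp at this
  mem_zpowers x hx hne := by
    -- By Cauchy `⟨x⟩` contains an involution, and `⟨a⟩` has only one.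
    have hd : 2 ∣ Nat.card (Subgroup.zpowers x) := by
      rw [Nat.card_zpowers]
      have h1 : orderOf x ∣ 2 ^ (k + e) := by
        rw [← h.card_eq]
        exact orderOf_dvd_natCard x
      obtain ⟨i, -, hi⟩ := (Nat.dvd_prime_pow Nat.prime_two).1 h1
      rw [hi]
      refine dvd_pow_self 2 ?_
      rintro rfl
      exact hne (orderOf_eq_one_iff.1 (by simpa using hi))
    have : Finite (Subgroup.zpowers x) := by
      have : Finite R := Nat.finite_of_card_ne_zero (by rw [h.card_eq]; positivity)
      infer_instance
    obtain ⟨⟨y, hy⟩, hy2⟩ := exists_prime_orderOf_dvd_card' 2 hd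
    rw [Subgroup.orderOf_mk] at hy2
    have hya : y ∈ Subgroup.zpowers a := (Subgroup.zpowers_le.2 hx) hy
    rcases h.eq_one_or_eq hya (hy2 ▸ pow_orderOf_eq_one y) with rfl | rfl
    · simp at hy2
    · exact hy
  commute g := by
    by_cases hg : g ∈ Subgroup.zpowers a
    · obtain ⟨i, rfl⟩ := hg
      exact ((Commute.refl a).zpow_left i).pow_right _
    · have hmem : a ^ 2 ^ (k - 1) ∈ Subgroup.zpowers a := Subgroup.npow_mem_zpowers a _
      have h1 := h.conj_mem hg hmem
      have hk : 2 ^ (k - 1) - 1 = 2 * (2 ^ (k - 2) - 1) + 1 := by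
        have h2 : k - 1 = k - 2 + 1 := by have := h.le; omega
        have h3 := Nat.one_le_two_pow (n := k - 2)
        rw [h2, pow_succ]
        omega
      rw [hk, pow_succ, pow_mul, h.pow_two_pow_sq, one_pow, one_mul,
        mul_inv_eq_iff_eq_mul] at h1
      exact h1

/-- The hypothesis says that an odd power of `x ^ 2` is trivial, since `2 ^ (k - 2) - 1` is odd.
This needs `k ≥ 3`, which holds because `hg` excludes `e = 0`. -/
theorem sq_eq_one_of_conj_eq (h : IsTwoCore k e a) {g x : R} (hg : g ∉ Subgroup.zpowers a)
    (hx : x ^ (2 ^ (k - 1) - 1) = x) : x ^ 2 = 1 := by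
  have he : e ≠ 0 := by
    rintro rfl
    refine hg ?_
    rw [Subgroup.index_eq_one.1 h.index_eq]
    trivial
  have hk : 2 ^ (k - 1) - 1 = 2 * (2 ^ (k - 2) - 1) + 1 := by
    have h2 : k - 1 = k - 2 + 1 := by have := h.le; omega
    have h3 := Nat.one_le_two_pow (n := k - 2)
    rw [h2, pow_succ]
    omega
  rw [hk, pow_succ, mul_eq_right, pow_mul] at hx
  refine h.eq_one_of_odd_pow ?_ hx
  refine Nat.Even.sub_odd Nat.one_le_two_pow ?_ odd_one
  exact (Nat.even_pow' (by have := h.le; omega)).2 even_two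

variable {k' e' : ℕ} {a' : R'}

theorem normal_prod (h : IsTwoCore k e a) (h' : IsTwoCore k' e' a') :
    ((Subgroup.zpowers a).prod (Subgroup.zpowers a')).Normal :=
  have := h.normal
  have := h'.normal
  Subgroup.prod_normal _ _

theorem two_pow_dvd_index (h : IsTwoCore k e a) (h' : IsTwoCore k' e' a') {L : Subgroup (R × R')}
    {m t : ℕ} (hL : Nat.card L ∣ 2 ^ m) (hm : m + t ≤ k + e + (k' + e')) : 2 ^ t ∣ L.index := by
  have hi := L.card_mul_index
  rw [Nat.card_prod, h.card_eq, h'.card_eq, ← pow_add] at hi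
  obtain ⟨i, him, hi'⟩ := (Nat.dvd_prime_pow Nat.prime_two).1 hL
  refine Nat.dvd_of_mul_dvd_mul_left (k := 2 ^ i) (by positivity) ?_
  rw [← hi', hi, hi', ← pow_add]
  exact pow_dvd_pow 2 (by omega)

theorem index_prod_eq (h : IsTwoCore k e a) (h' : IsTwoCore k' e' a') :
    ((Subgroup.zpowers a).prod (Subgroup.zpowers a')).index = 2 ^ (e + e') := by
  rw [Subgroup.index_prod, h.index_eq, h'.index_eq, pow_add]

/-- A subgroup of `R × R'` that contains none of the three involutions of `⟨a⟩ × ⟨a'⟩` meets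
`⟨a⟩ × ⟨a'⟩` trivially. -/
theorem card_dvd_of_notMem (h : IsTwoCore k e a) (h' : IsTwoCore k' e' a') {L : Subgroup (R × R')}
    (h1 : ((a ^ 2 ^ (k - 1), 1) : R × R') ∉ L) (h2 : ((1, a' ^ 2 ^ (k' - 1)) : R × R') ∉ L)
    (h3 : ((a ^ 2 ^ (k - 1), a' ^ 2 ^ (k' - 1)) : R × R') ∉ L) :
    Nat.card L ∣ 2 ^ (e + e') := by
  have := h.normal_prod h'
  have : Finite R := Nat.finite_of_card_ne_zero (by rw [h.card_eq]; positivity)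
  have : Finite R' := Nat.finite_of_card_ne_zero (by rw [h'.card_eq]; positivity)
  let P := (Subgroup.zpowers a).prod (Subgroup.zpowers a')
  -- A nontrivial intersection would contain an involution by Cauchy, and `⟨a⟩ × ⟨a'⟩` has only the
  -- three excluded ones.
  have hbot : P.subgroupOf L = ⊥ := by
    by_contra hne
    have hd : 2 ∣ Nat.card (P.subgroupOf L) := by
      have hd : Nat.card (P.subgroupOf L) ∣ 2 ^ (k + e + (k' + e')) := by
        refine (Subgroup.card_subgroup_dvd_card _).trans ?_
        rw [pow_add, ← h.card_eq, ← h'.card_eq, ← Nat.card_prod]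
        exact Subgroup.card_subgroup_dvd_card L
      obtain ⟨i, -, hi⟩ := (Nat.dvd_prime_pow Nat.prime_two).1 hd
      rw [hi]
      refine dvd_pow_self 2 ?_
      rintro rfl
      exact hne (Subgroup.card_eq_one.1 (by simpa using hi))
    obtain ⟨⟨⟨⟨x, y⟩, hxyL⟩, hxyP⟩, ho⟩ := exists_prime_orderOf_dvd_card' 2 hd
    rw [Subgroup.orderOf_mk, Subgroup.orderOf_mk] at ho
    obtain ⟨hx, hy⟩ := Subgroup.mem_prod.1 (Subgroup.mem_subgroupOf.1 hxyP)
    have hsq : ((x, y) : R × R') ^ 2 = 1 := ho ▸ pow_orderOf_eq_one _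
    obtain ⟨hx2, hy2⟩ := Prod.ext_iff.1 hsq
    rcases h.eq_one_or_eq hx hx2 with rfl | rfl <;> rcases h'.eq_one_or_eq hy hy2 with rfl | rfl
    · rw [← Prod.one_eq_mk, orderOf_one] at ho
      omega
    · exact h2 hxyL
    · exact h1 hxyL
    · exact h3 hxyL
  have hd : P.relIndex L ∣ P.index := Subgroup.relIndex_dvd_index_of_normal _ _
  rwa [Subgroup.relIndex, hbot, Subgroup.index_bot, h.index_prod_eq h'] at hd

/-- A bound for the order of a subgroup of `R × R'` that contains neither of the involutions of
`⟨a⟩` and `⟨a'⟩`. -/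
theorem card_dvd_of_left_right_notMem (h : IsTwoCore k e a) (h' : IsTwoCore k' e' a') (hkk : k ≠ k')
    {L : Subgroup (R × R')} (h1 : ((a ^ 2 ^ (k - 1), 1) : R × R') ∉ L)
    (h2 : ((1, a' ^ 2 ^ (k' - 1)) : R × R') ∉ L) : Nat.card L ∣ 2 ^ (k' + e - 1) := by
  have := h.normal_prod h'
  have := h.normal
  have : Finite R := Nat.finite_of_card_ne_zero (by rw [h.card_eq]; positivity)
  have : Finite R' := Nat.finite_of_card_ne_zero (by rw [h'.card_eq]; positivity)
  have hle := h.le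
  have hle' := h'.le
  let P := (Subgroup.zpowers a).prod (Subgroup.zpowers a')
  have hcard : Nat.card (P.subgroupOf L) * P.relIndex L = Nat.card L :=
    Subgroup.card_mul_index _
  have hindex : P.relIndex L ∣ 2 ^ (e + e') := by
    rw [← h.index_prod_eq h']
    exact Subgroup.relIndex_dvd_index_of_normal _ _
  have hmem (g : P.subgroupOf L) : (g : L).1.1 ∈ Subgroup.zpowers a ∧
      (g : L).1.2 ∈ Subgroup.zpowers a' :=
    Subgroup.mem_prod.1 (Subgroup.mem_subgroupOf.1 g.2)
  -- Avoiding the two involutions makes both projections of `L ∩ P` injective: it is the graph of an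
  -- isomorphism between subgroups of `⟨a⟩` and `⟨a'⟩`.
  have hinj₁ (g : P.subgroupOf L) (hg : (g : L).1.1 = 1) : g = 1 := by
    refine Subtype.ext (Subtype.ext (Prod.ext hg ?_))
    refine h'.isCore.eq_one_of_right_mem h2 (hmem g).2 ?_
    rw [← hg]
    exact g.1.2
  have hinj₂ (g : P.subgroupOf L) (hg : (g : L).1.2 = 1) : g = 1 := by
    refine Subtype.ext (Subtype.ext (Prod.ext ?_ hg))
    refine h.isCore.eq_one_of_left_mem h1 (hmem g).1 ?_
    rw [← hg]
    exact g.1.2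
  let π₁ : P.subgroupOf L →* R :=
    (MonoidHom.fst R R').comp (L.subtype.comp (P.subgroupOf L).subtype)
  let π₂ : P.subgroupOf L →* R' :=
    (MonoidHom.snd R R').comp (L.subtype.comp (P.subgroupOf L).subtype)
  by_cases hexp : ∀ g : P.subgroupOf L, (g : L).1.1 ^ 2 = 1
  · have hd : Nat.card (P.subgroupOf L) ∣ 2 := by
      let f := π₁.codRestrict (Subgroup.zpowers (a ^ 2 ^ (k - 1))) fun g => by
        rcases h.eq_one_or_eq (hmem g).1 (hexp g) with hg | hg
        · exact Subgroup.mem_carrier.1 (Set.mem_of_eq_of_mem hg (Subgroup.one_mem _))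
        · exact Subgroup.mem_carrier.1 (Set.mem_of_eq_of_mem hg (Subgroup.mem_zpowers _))
      have hf : Function.Injective f := (injective_iff_map_eq_one f).2 fun g hg =>
        hinj₁ g (congrArg Subtype.val hg)
      have := Subgroup.card_dvd_of_injective f hf
      rwa [Nat.card_zpowers, h.orderOf_pow] at this
    rw [← hcard]
    refine (mul_dvd_mul hd hindex).trans ?_
    rw [← pow_succ']
    exact pow_dvd_pow 2 (by omega)
  · push Not at hexp
    obtain ⟨⟨⟨⟨x, y⟩, hxyL⟩, hxyP⟩, hx2⟩ := hexp
    obtain ⟨hx, hy⟩ := Subgroup.mem_prod.1 (Subgroup.mem_subgroupOf.1 hxyP)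
    simp only at hx hy hx2
    have hy2 : y ^ 2 ≠ 1 := by
      intro hy2
      refine hx2 (h.isCore.eq_one_of_left_mem h1 (Subgroup.pow_mem _ hx 2) ?_)
      rw [← hy2]
      exact L.pow_mem hxyL 2
    -- If just one coordinate of `g` were outside its cyclic group, the commutator of `g` with `(x,
    -- y)` would be trivial in the other coordinate, hence trivial; but a semidihedral action
    -- centralizes only elements with square 1.
    have hiff : ∀ g ∈ L, g.1 ∈ Subgroup.zpowers a ↔ g.2 ∈ Subgroup.zpowers a' := by
      rintro ⟨r, r'⟩ hg
      have hc : ((r * x * r⁻¹, r' * y * r'⁻¹) : R × R') ∈ L :=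
        L.mul_mem (L.mul_mem hg hxyL) (L.inv_mem hg)
      have hq : ((r * x * r⁻¹ * x⁻¹, r' * y * r'⁻¹ * y⁻¹) : R × R') ∈ L :=
        L.mul_mem hc (L.inv_mem hxyL)
      by_cases hr : r ∈ Subgroup.zpowers a <;> by_cases hr' : r' ∈ Subgroup.zpowers a'
      · simp [hr, hr']
      · exfalso
        refine hy2 (h'.sq_eq_one_of_conj_eq hr' ?_)
        have hcomm : r * x * r⁻¹ * x⁻¹ = 1 := by
          rw [← commutatorElement_def, commutatorElement_eq_one_iff_commute]
          exact commute_of_mem_zpowers hr hx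
        rw [hcomm, h'.conj_mem hr' hy] at hq
        rw [← mul_inv_eq_one]
        exact h'.isCore.eq_one_of_right_mem h2
          (Subgroup.mul_mem _ (Subgroup.pow_mem _ hy _) (Subgroup.inv_mem _ hy)) hq
      · exfalso
        refine hx2 (h.sq_eq_one_of_conj_eq hr ?_)
        have hcomm : r' * y * r'⁻¹ * y⁻¹ = 1 := by
          rw [← commutatorElement_def, commutatorElement_eq_one_iff_commute]
          exact commute_of_mem_zpowers hr' hy
        rw [hcomm, h.conj_mem hr hx] at hq
        rw [← mul_inv_eq_one]
        exact h.isCore.eq_one_of_left_mem h1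
          (Subgroup.mul_mem _ (Subgroup.pow_mem _ hx _) (Subgroup.inv_mem _ hx)) hq
      · simp [hr, hr']
    -- By `hiff` membership in `P` is tested on the first coordinate alone, which saves the factor
    -- `2 ^ e'`.
    have hindex_e : P.relIndex L ∣ 2 ^ e := by
      have heq : P.subgroupOf L =
          ((Subgroup.zpowers a).prod (⊤ : Subgroup R')).subgroupOf L := by
        ext g
        simp only [P, Subgroup.mem_subgroupOf, Subgroup.mem_prod, Subgroup.mem_top, and_true]
        exact ⟨fun hg => hg.1, fun hg => ⟨hg, (hiff g g.2).1 hg⟩⟩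
      have hd : ((Subgroup.zpowers a).prod (⊤ : Subgroup R')).relIndex L ∣ _ :=
        Subgroup.relIndex_dvd_index_of_normal _ _
      rw [Subgroup.index_prod, h.index_eq, Subgroup.index_top, mul_one] at hd
      rwa [Subgroup.relIndex, heq]
    let f₁ := π₁.codRestrict (Subgroup.zpowers a) fun g => (hmem g).1
    let f₂ := π₂.codRestrict (Subgroup.zpowers a') fun g => (hmem g).2
    have hf₁ : Function.Injective f₁ := (injective_iff_map_eq_one f₁).2 fun g hg =>
      hinj₁ g (congrArg Subtype.val hg)
    have hf₂ : Function.Injective f₂ := (injective_iff_map_eq_one f₂).2 fun g hg =>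
      hinj₂ g (congrArg Subtype.val hg)
    have hd₁ := Subgroup.card_dvd_of_injective f₁ hf₁
    have hd₂ := Subgroup.card_dvd_of_injective f₂ hf₂
    rw [Nat.card_zpowers, h.orderOf_eq] at hd₁
    rw [Nat.card_zpowers, h'.orderOf_eq] at hd₂
    obtain ⟨j, hj, hcj⟩ := (Nat.dvd_prime_pow Nat.prime_two).1 hd₂
    have hjk : j ≤ k := by
      rw [hcj] at hd₁
      exact Nat.pow_dvd_pow_iff_le_right'.1 hd₁
    rw [← hcard, hcj]
    rcases hj.lt_or_eq with hlt | rfl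
    · refine (mul_dvd_mul_left _ hindex_e).trans ?_
      rw [← pow_add]
      exact pow_dvd_pow 2 (by omega)
    -- Extreme case: `L ∩ P` projects onto `⟨a'⟩`, and `j` is now `k'`. The bound must come from `L
    -- ≤ P` and `e ≠ 0`; the case `e = 0` would give `k = 2 ≤ k'`.
    · have hlt : j < k := lt_of_le_of_ne hjk hkk.symm
      have he : e ≠ 0 := fun he => by have := h.eq_two he; omega
      have hsurj : Function.Surjective f₂ := by
        refine ((Nat.bijective_iff_injective_and_card f₂).2 ⟨hf₂, ?_⟩).2
        rw [hcj, Nat.card_zpowers, h'.orderOf_eq]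
      obtain ⟨⟨⟨⟨x₀, y₀⟩, hL₀⟩, hP₀⟩, hy₀⟩ := hsurj ⟨a', Subgroup.mem_zpowers a'⟩
      obtain rfl : y₀ = a' := congrArg Subtype.val hy₀
      obtain ⟨hx₀, -⟩ := Subgroup.mem_prod.1 (Subgroup.mem_subgroupOf.1 hP₀)
      simp only at hx₀
      have hLP : L ≤ P := by
        rintro ⟨r, r'⟩ hg
        by_contra hgP
        have hr : r ∉ Subgroup.zpowers a := fun hr =>
          hgP (Subgroup.mem_prod.2 ⟨hr, (hiff _ hg).1 hr⟩)
        have hr' : r' ∉ Subgroup.zpowers y₀ := fun hr' => hr ((hiff _ hg).2 hr')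
        have hc : ((r * x₀ * r⁻¹, r' * y₀ * r'⁻¹) : R × R') ∈ L :=
          L.mul_mem (L.mul_mem hg hL₀) (L.inv_mem hg)
        rw [h.conj_mem hr hx₀, h'.conj r' hr'] at hc
        have hq := L.mul_mem hc (L.inv_mem (L.pow_mem hL₀ (2 ^ (k - 1) - 1)))
        rw [Prod.pow_mk, Prod.inv_mk, Prod.mk_mul_mk, mul_inv_cancel] at hq
        have heq := mul_inv_eq_one.1 (h'.isCore.eq_one_of_right_mem h2
          (Subgroup.mul_mem _ (Subgroup.pow_mem _ (Subgroup.mem_zpowers _) _)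
            (Subgroup.inv_mem _ (Subgroup.pow_mem _ (Subgroup.mem_zpowers _) _))) hq)
        -- An element of `L` outside `P` would act by the exponent for `k` and by the one for `j` at
        -- once. These differ by an odd multiple of `2 ^ (j - 1)`, which would force the involution
        -- of `⟨a'⟩` to be trivial.
        have hpow : 2 ^ (k - 1) - 1 = (2 ^ (j - 1) - 1) + 2 ^ (j - 1) * (2 ^ (k - j) - 1) := by
          have e1 : 2 ^ (k - 1) = 2 ^ (j - 1) * 2 ^ (k - j) := by
            rw [← pow_add]
            congr 1
            omega
          have e2 := Nat.one_le_two_pow (n := j - 1)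
          have e3 := Nat.one_le_two_pow (n := k - j)
          rw [e1, Nat.mul_sub, mul_one]
          have := Nat.mul_le_mul_left (2 ^ (j - 1)) e3
          omega
        rw [hpow, pow_add, left_eq_mul, pow_mul] at heq
        refine h'.isCore.ne_one (h'.eq_one_of_odd_pow ?_ heq)
        refine Nat.Even.sub_odd Nat.one_le_two_pow ?_ odd_one
        exact (Nat.even_pow' (by omega)).2 even_two
      rw [Subgroup.relIndex_eq_one.2 hLP, mul_one]
      exact pow_dvd_pow 2 (by omega)

/-- When `L` contains `(z, z')` but neither factor, the weight 2 supplies one power of 2 and the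
index the rest; when it contains none of the three, the index alone suffices because `e' + 2 ≤ k'`.
-/
theorem two_pow_dvd_weight_mul_index (h : IsTwoCore k e a) (h' : IsTwoCore k' e' a')
    (hkk : k ≠ k') (L : Subgroup (R × R')) :
    ((2 ^ (k + e' + 2) : ℕ) : ℤ) ∣
      weight ((a ^ 2 ^ (k - 1), 1) : R × R') (1, a' ^ 2 ^ (k' - 1)) L * (L.index : ℤ) := by
  have hle' := h'.le
  by_cases h1 : ((a ^ 2 ^ (k - 1), 1) : R × R') ∈ L
  · simp [weight_of_left_mem h1]
  by_cases h2 : ((1, a' ^ 2 ^ (k' - 1)) : R × R') ∈ L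
  · simp [weight_of_right_mem h2]
  by_cases h3 : ((a ^ 2 ^ (k - 1), 1) * (1, a' ^ 2 ^ (k' - 1)) : R × R') ∈ L
  · rw [weight_of_mul_mem h1 h2 h3, pow_succ']
    push_cast
    refine mul_dvd_mul_left 2 ?_
    exact_mod_cast h.two_pow_dvd_index h' (h.card_dvd_of_left_right_notMem h' hkk h1 h2) (by omega)
  · rw [weight_of_notMem h1 h2 h3, one_mul]
    rw [Prod.mk_mul_mk, mul_one, one_mul] at h3
    exact_mod_cast h.two_pow_dvd_index h' (h.card_dvd_of_notMem h' h1 h2 h3) (by omega)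

theorem two_pow_dvd_fixCard (h : IsTwoCore k e a) (h' : IsTwoCore k' e' a') (hkk : k ≠ k')
    {U : Type} [MulAction (R × R') U] [Finite U] :
    ((2 ^ (k + e' + 2) : ℕ) : ℤ) ∣
      fixCard U (1 : R × R') - fixCard U ((a ^ 2 ^ (k - 1), 1) : R × R') -
        fixCard U ((1, a' ^ 2 ^ (k' - 1)) : R × R') +
        fixCard U ((a ^ 2 ^ (k - 1), a' ^ 2 ^ (k' - 1)) : R × R') := by
  have := Fintype.ofFinite U
  have hzz : ((a ^ 2 ^ (k - 1), a' ^ 2 ^ (k' - 1)) : R × R') =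
      (a ^ 2 ^ (k - 1), 1) * (1, a' ^ 2 ^ (k' - 1)) := by simp
  rw [hzz, ← sum_weight_stabilizer]
  exact dvd_sum_of_dvd_mul_index (Γ := R × R') _
    (weight_stabilizer_smul h.isCore.commute_left h'.isCore.commute_right)
    fun u => h.two_pow_dvd_weight_mul_index h' hkk _

end IsTwoCore

/-! ### The parity of the number of free orbits -/

/-- A nontrivial stabilizer in `⟨a⟩` contains `z`, so the points moved by `z` are those in free
`⟨a⟩`-orbits. -/
theorem IsCore.orderOf_dvd_moved {a z : R} (h : IsCore a z) (X : FinGSet R) :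
    orderOf a ∣ moved z X := by
  classical
  have := Fintype.ofFinite X.carrier
  let w : X.carrier → ℤ := fun x => if z • x = x then 0 else 1
  have hw : (moved z X : ℤ) = ∑ x, w x := by
    simp [w, moved, Nat.card_eq_fintype_card, Fintype.card_subtype, Finset.sum_ite]
  rw [← Int.natCast_dvd_natCast, hw]
  refine dvd_sum_of_dvd_mul_index (Γ := Subgroup.zpowers a) w (fun g x => ?_) fun x => ?_
  · have : z • g • x = g • x ↔ z • x = x := by
      change z • (g : R) • x = (g : R) • x ↔ _
      rw [smul_smul, ← (h.commute g).eq, mul_smul, smul_left_cancel_iff]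
    simp only [w, this]
  · by_cases hx : z • x = x
    · simp [w, hx]
    · have hbot : MulAction.stabilizer (Subgroup.zpowers a) x = ⊥ := by
        rw [Subgroup.eq_bot_iff_forall]
        rintro ⟨g, hg⟩ hgx
        by_contra hne
        refine hx ?_
        have hle : Subgroup.zpowers g ≤ MulAction.stabilizer R x := Subgroup.zpowers_le.2 hgx
        exact hle (h.mem_zpowers g hg fun h1 => hne (Subtype.ext h1))
      rw [hbot, Subgroup.index_bot, Nat.card_zpowers]
      exact dvd_mul_left _ _

/-- The linear form on `𝔽₂B(R)` that maps the class of `X` to the parity of the number of free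
orbits of `⟨a⟩` on `X`. -/
def freeOrbitParity {a z : R} (h : IsCore a z) :
    Burnside (ZMod 2) R →ₗ[ZMod 2] ULift.{1} (ZMod 2) :=
  Burnside.lift (fun X => ⟨((moved z X / orderOf a : ℕ) : ZMod 2)⟩)
    (fun X Y hXY => by rw [moved_eq_of_iso z hXY])
    (fun X Y => by
      -- Natural division is additive here only because it is exact.
      rw [moved_disjUnion, Nat.add_div_of_dvd_right (h.orderOf_dvd_moved X), Nat.cast_add]
      rfl)

theorem freeOrbitParity_cls_sub {a z : R} (h : IsCore a z) (X Y : FinGSet R) :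
    freeOrbitParity h (Burnside.cls _ X - Burnside.cls _ Y) =
      ⟨((moved z X / orderOf a : ℕ) : ZMod 2) - ((moved z Y / orderOf a : ℕ) : ZMod 2)⟩ := by
  rw [map_sub, freeOrbitParity, Burnside.lift_cls, Burnside.lift_cls]
  rfl

theorem freeOrbitParity_coset_ne_zero [Finite R] {a z : R} (h : IsCore a z) {H K : Subgroup R}
    (hH : z ∉ H) (hK : z ∈ K) (hi : H.index = orderOf a) :
    freeOrbitParity h (Burnside.cls _ (FinGSet.coset R H) - Burnside.cls _ (FinGSet.coset R K)) ≠
      0 := by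
  rw [freeOrbitParity_cls_sub, moved_coset_of_notMem h.commute hH, moved_coset_of_mem h.commute hK,
    hi, Nat.div_self (orderOf_pos a), Nat.zero_div]
  intro h0
  have := congrArg ULift.down h0
  simp at this

theorem sub_mem_detected {a z : R} (h : IsCore a z) {G : FiniteGrp.{0}} (X Y : FinGSet G)
    (hd : ∀ U : FinBiset R G,
      2 * (orderOf a : ℤ) ∣ moved z (U.tensor X) - moved z (U.tensor Y)) :
    Burnside.cls _ X - Burnside.cls _ Y ∈
      (BurnsideSubfunctor.detected (freeOrbitParity h)).obj G := by
  rw [BurnsideSubfunctor.mem_detected]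
  intro U
  rw [map_sub, bisetMap_cls, bisetMap_cls, freeOrbitParity_cls_sub]
  refine congrArg ULift.up ?_
  obtain ⟨m, hm⟩ := h.orderOf_dvd_moved (U.tensor X)
  obtain ⟨n, hn⟩ := h.orderOf_dvd_moved (U.tensor Y)
  have hU := hd U
  rw [hm, hn] at hU ⊢
  rcases Nat.eq_zero_or_pos (orderOf a) with h0 | h0
  · simp [h0]
  rw [Nat.mul_div_cancel_left _ h0, Nat.mul_div_cancel_left _ h0]
  push_cast at hU
  rw [mul_comm 2, ← mul_sub] at hU
  have h2 := Int.dvd_of_mul_dvd_mul_left (by exact_mod_cast h0.ne') hU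
  have := (ZMod.intCast_zmod_eq_zero_iff_dvd (m - n) 2).2 (by exact_mod_cast h2)
  simpa using this

/-! ### Groups of prime order, cyclic groups of order `4`, semidihedral groups -/

theorem isCore_of_prime_card (hp : (Nat.card R).Prime) {z : R} (hz : z ≠ 1) : IsCore z z := by
  have := Fact.mk hp
  have hmem {x : R} (hx : x ≠ 1) (y : R) : y ∈ Subgroup.zpowers x :=
    mem_zpowers_of_prime_card (p := Nat.card R) rfl hx
  exact ⟨Subgroup.mem_zpowers z, hz, fun x _ hx => hmem hx z,
    fun g => commute_of_mem_zpowers (hmem hz g) (hmem hz z)⟩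

theorem orderOf_of_prime_card (hp : (Nat.card R).Prime) {z : R} (hz : z ≠ 1) :
    orderOf z = Nat.card R := by
  have := Fact.mk hp
  exact orderOf_eq_card_of_forall_mem_zpowers fun _ =>
    mem_zpowers_of_prime_card (p := Nat.card R) rfl hz

theorem exists_isTwoCore_of_isCyclic (hc : IsCyclic R) (h4 : Nat.card R = 4) :
    ∃ a : R, IsTwoCore 2 0 a := by
  obtain ⟨a, ha⟩ := hc.exists_generator
  refine ⟨a, ?_, h4, le_rfl, fun _ => rfl, fun g hg => absurd (ha g) hg⟩
  rw [orderOf_eq_card_of_forall_mem_zpowers ha, h4]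
  norm_num

theorem IsSemidihedral.exists_isTwoCore {n : ℕ} (hn : 4 ≤ n) (h : IsSemidihedral n R) :
    ∃ a b : R, IsTwoCore (n - 1) 1 a ∧ orderOf b = 2 ∧ b ∉ Subgroup.zpowers a := by
  obtain ⟨hcard, a, b, ha, hb, hab, -⟩ := h
  have hn1 : n - 1 + 1 = n := by omega
  have hindex : (Subgroup.zpowers a).index = 2 := by
    have := (Subgroup.zpowers a).card_mul_index
    rw [Nat.card_zpowers, ha, hcard, ← hn1, pow_succ] at this
    exact Nat.eq_of_mul_eq_mul_left (by positivity) this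
  have hbmem : b ∉ Subgroup.zpowers a := by
    -- Otherwise `a` and `b` commute and `a ^ (2 ^ (n - 2) - 2) = 1`, with a positive exponent
    -- smaller than the order of `a`.
    intro hmem
    rw [(commute_of_mem_zpowers hmem (Subgroup.mem_zpowers a)).eq, mul_inv_cancel_right] at hab
    have h1 : 2 ^ (n - 2) = 4 * 2 ^ (n - 4) := by
      rw [show n - 2 = 2 + (n - 4) by omega, pow_add]
      norm_num
    have h2 : 2 ^ (n - 1) = 8 * 2 ^ (n - 4) := by
      rw [show n - 1 = 3 + (n - 4) by omega, pow_add]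
      norm_num
    have h3 := Nat.one_le_two_pow (n := n - 4)
    have h4 : 2 ^ (n - 2) - 1 = (4 * 2 ^ (n - 4) - 2) + 1 := by omega
    rw [h4, pow_succ, right_eq_mul] at hab
    have h5 := Nat.le_of_dvd (by omega) (orderOf_dvd_of_pow_eq_one hab)
    omega
  refine ⟨a, b, ⟨ha, by rw [hcard, hn1], by omega, by simp, fun g hg => ?_⟩, hb, hbmem⟩
  -- The index is 2, so `g` lies in `b⟨a⟩` and acts on `⟨a⟩` as `b` does.
  have hc : b⁻¹ * g ∈ Subgroup.zpowers a := by
    rw [Subgroup.mul_mem_iff_of_index_two hindex, Subgroup.inv_mem_iff]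
    simp [hbmem, hg]
  have hcomm := (commute_of_mem_zpowers hc (Subgroup.mem_zpowers a)).eq
  rw [show n - 1 - 1 = n - 2 by omega, ← hab, mul_inv_eq_iff_eq_mul]
  have : g = b * (b⁻¹ * g) := by group
  rw [this, mul_assoc, hcomm]
  group

theorem exists_mem_iff_of_card_eq_two {I : Subgroup R} (hI : Nat.card I = 2) :
    ∃ i : R, i ≠ 1 ∧ i ^ 2 = 1 ∧ ∀ x, x ∈ I ↔ x = 1 ∨ x = i := by
  obtain ⟨⟨i, hi⟩, hne, huniv⟩ := (Nat.card_eq_two_iff' (1 : I)).1 hI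
  refine ⟨i, fun h => hne (Subtype.ext h), ?_, fun x => ⟨fun hx => ?_, ?_⟩⟩
  · have := pow_card_eq_one' (x := (⟨i, hi⟩ : I))
    rw [hI] at this
    exact congrArg Subtype.val this
  · by_cases hx1 : x = 1
    · exact Or.inl hx1
    · exact Or.inr (congrArg Subtype.val (huniv ⟨x, hx⟩ fun h => hx1 (congrArg Subtype.val h)))
  · rintro (rfl | rfl)
    · exact I.one_mem
    · exact hi

namespace IsTwoCore

variable {k e : ℕ} {a : R}

/-- Needed because an `(R, R')`-biset is a set for `R × R'ᵐᵒᵖ`. Conjugation by `g` in the opposite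
group is conjugation by the inverse in `R`. -/
theorem op (h : IsTwoCore k e a) : IsTwoCore k e (MulOpposite.op a) where
  orderOf_eq := by
    rw [← h.orderOf_eq]
    refine orderOf_eq_orderOf_iff.2 fun n => ?_
    rw [← MulOpposite.op_pow, MulOpposite.op_eq_one_iff]
  card_eq := by rw [← h.card_eq, ← Nat.card_congr (MulOpposite.opEquiv (α := R))]
  le := h.le
  eq_two := h.eq_two
  conj g hg := by
    have hg' : g.unop⁻¹ ∉ Subgroup.zpowers a := by
      rw [Subgroup.inv_mem_iff]
      rintro ⟨i, hi⟩
      exact hg ⟨i, MulOpposite.unop_injective (by simpa using hi)⟩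
    have := h.conj _ hg'
    apply MulOpposite.unop_injective
    simpa [mul_assoc] using this

theorem mem_center_iff (h : IsTwoCore k 1 a) {x : R} :
    x ∈ Subgroup.center R ↔ x = 1 ∨ x = a ^ 2 ^ (k - 1) := by
  have hle := h.le
  constructor
  · intro hx
    have hc (g : R) : g * x * g⁻¹ = x := by
      rw [Subgroup.mem_center_iff.1 hx g, mul_inv_cancel_right]
    have hxa : x ∈ Subgroup.zpowers a := by
      by_contra hxa
      have hconj := h.conj x hxa
      rw [← Subgroup.mem_center_iff.1 hx a, mul_inv_cancel_right] at hconj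
      have h2 := orderOf_dvd_of_pow_eq_one (h.sq_eq_one_of_conj_eq hxa hconj.symm)
      rw [h.orderOf_eq] at h2
      have := Nat.pow_dvd_pow_iff_le_right'.1 (h2.trans (pow_one 2).symm.dvd)
      omega
    have hne : Subgroup.zpowers a ≠ ⊤ := fun htop => by
      have := h.index_eq
      rw [htop, Subgroup.index_top] at this
      omega
    obtain ⟨g, hg⟩ : ∃ g, g ∉ Subgroup.zpowers a := by
      by_contra! hall
      exact hne ((Subgroup.eq_top_iff' _).2 hall)
    refine h.eq_one_or_eq hxa (h.sq_eq_one_of_conj_eq hg ?_)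
    rw [← h.conj_mem hg hxa, hc]
  · rintro (rfl | rfl)
    · exact Subgroup.one_mem _
    · exact Subgroup.mem_center_iff.2 fun g => (h.isCore.commute g).eq

/-- Take `t` of order 4 in `⟨a⟩`. As `k ≥ 3`, the exponent `2 ^ (k - 1) - 1` is 3 modulo 4, so `i`
inverts `t`, and the commutator of `t` and `i` is the central involution. -/
theorem exists_conj_eq_mul (h : IsTwoCore k 1 a) {i : R} (hi : i ∉ Subgroup.zpowers a)
    (hi2 : i ^ 2 = 1) : ∃ t : R, t * i * t⁻¹ = i * a ^ 2 ^ (k - 1) := by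
  have hle := h.le
  let t := a ^ 2 ^ (k - 2)
  have ht2 : t ^ 2 = a ^ 2 ^ (k - 1) := by
    rw [← pow_mul, ← pow_succ, show k - 2 + 1 = k - 1 by omega]
  have hinv : i⁻¹ = i := inv_eq_of_mul_eq_one_left (by rw [← sq, hi2])
  have hconj := h.conj_mem hi (Subgroup.npow_mem_zpowers a (2 ^ (k - 2)))
  have hexp : 2 ^ (k - 1) - 1 = 2 * (2 * (2 ^ (k - 3) - 1)) + 2 + 1 := by
    have h2 : k - 1 = k - 3 + 1 + 1 := by omega
    have h3 := Nat.one_le_two_pow (n := k - 3)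
    rw [h2, pow_succ, pow_succ]
    omega
  have hts : t ^ (2 ^ (k - 1) - 1) = a ^ 2 ^ (k - 1) * t := by
    rw [hexp, pow_succ, pow_add, pow_mul, ht2, pow_mul, h.pow_two_pow_sq, one_pow, one_mul]
  refine ⟨t, ?_⟩
  change i * t * i⁻¹ = t ^ _ at hconj
  rw [hts, hinv] at hconj
  rw [mul_inv_eq_iff_eq_mul, mul_assoc, ← hconj, ← mul_assoc, ← mul_assoc, ← sq, hi2, one_mul]

end IsTwoCore

/-! ### The value of `[U]` on the generators -/

section Tensor

variable {a z : R} (U : FinBiset R R')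

/-- The number of points of `U` fixed by `(1, h)`, minus the number of those fixed by `(z, h)`. -/
def fixDiff (z : R) (h : R') : ℤ :=
  fixCard U.carrier ((1, .op h) : R × R'ᵐᵒᵖ) - fixCard U.carrier ((z, .op h) : R × R'ᵐᵒᵖ)

theorem fixDiff_conj (z : R) (t h : R') : fixDiff U z (t * h * t⁻¹) = fixDiff U z h := by
  have key (r : R) : fixCard U.carrier ((r, .op (t * h * t⁻¹)) : R × R'ᵐᵒᵖ) =
      fixCard U.carrier ((r, .op h) : R × R'ᵐᵒᵖ) := by
    rw [← fixCard_conj ((1, .op t⁻¹) : R × R'ᵐᵒᵖ) (r, .op h)]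
    simp [mul_assoc]
  rw [fixDiff, key, key, fixDiff]

variable [Finite R']

theorem card_mul_moved_eq_sum (z : R) {H : Subgroup R'} (s : Finset R') (hs : ∀ x, x ∈ s ↔ x ∈ H) :
    (s.card : ℤ) * moved z (U.tensor (FinGSet.coset R' H)) = ∑ h ∈ s, fixDiff U z h := by
  have := Fintype.ofFinite H
  have hc : s.card = Nat.card H := by
    rw [Nat.card_eq_fintype_card, Fintype.card_of_subtype s hs]
  rw [hc, card_mul_moved_tensor, Finset.sum_subtype s hs]
  rfl

theorem moved_tensor_bot (z : R) :
    (moved z (U.tensor (FinGSet.coset R' ⊥)) : ℤ) = fixDiff U z 1 := by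
  have := card_mul_moved_eq_sum U z (H := ⊥) {1} (by simp)
  simpa using this

theorem dvd_moved_sub_of_prime (h : IsCore a z) (hq : (Nat.card R').Prime)
    (hodd : Odd (Nat.card R')) (hc : (orderOf a).Coprime (Nat.card R')) :
    2 * (orderOf a : ℤ) ∣ moved z (U.tensor (FinGSet.coset R' ⊥)) -
      moved z (U.tensor (FinGSet.coset R' ⊤)) := by
  classical
  have := Fintype.ofFinite R'
  have : Nontrivial R' := Finite.one_lt_card_iff_nontrivial.1 hq.one_lt
  obtain ⟨y, hy⟩ := exists_ne (1 : R')
  have hfact := Fact.mk hq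
  have hz : orderOf z ∣ orderOf a := orderOf_dvd_of_mem_zpowers h.mem
  have hyop : (MulOpposite.op y) ≠ 1 := by simpa using hy
  have hqop : Nat.card R'ᵐᵒᵖ = Nat.card R' := Nat.card_congr MulOpposite.opEquiv.symm
  -- Nontrivial elements of `R'` generate the same subgroup, and by coprimality `(z, x)` fixes a
  -- point exactly when `(z, 1)` and `(1, x)` both do.
  have hconst : ∀ x ∈ Finset.univ.erase (1 : R'), fixDiff U z x = fixDiff U z y := by
    intro x hx
    have hx1 : x ≠ 1 := (Finset.mem_erase.1 hx).1
    have hiff {x y : R'} (hx : x ≠ 1) {L : Subgroup (R × R'ᵐᵒᵖ)}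
        (hL : ((1, .op x) : R × R'ᵐᵒᵖ) ∈ L) : ((1, .op y) : R × R'ᵐᵒᵖ) ∈ L := by
      obtain ⟨i, rfl⟩ := mem_zpowers_of_prime_card (p := Nat.card R') rfl hx (g' := y)
      have := L.zpow_mem hL i
      simpa using this
    have hsplit (x : R') (L : Subgroup (R × R'ᵐᵒᵖ)) : ((z, .op x) : R × R'ᵐᵒᵖ) ∈ L ↔
        ((z, 1) : R × R'ᵐᵒᵖ) ∈ L ∧ ((1, .op x) : R × R'ᵐᵒᵖ) ∈ L := by
      have hmul : ((z, .op x) : R × R'ᵐᵒᵖ) = (z, 1) * (1, .op x) := by simp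
      have h1 : ((z, .op x) : R × R'ᵐᵒᵖ) ∈ L → ((z, 1) : R × R'ᵐᵒᵖ) ∈ L := by
        intro hL
        obtain ⟨m, hm⟩ := exists_pow_eq_self_of_coprime (x := z) (n := Nat.card R')
          (hc.symm.coprime_dvd_right hz)
        have := L.pow_mem (L.pow_mem hL (Nat.card R')) m
        have hxq : x ^ Nat.card R' = 1 := pow_card_eq_one'
        rwa [Prod.pow_mk, Prod.pow_mk, hm, ← MulOpposite.op_pow, hxq, MulOpposite.op_one,
          one_pow] at this
      refine ⟨fun hL => ⟨h1 hL, ?_⟩, fun hL => hmul ▸ L.mul_mem hL.1 hL.2⟩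
      rw [hmul] at hL
      exact (L.mul_mem_cancel_left (h1 (hmul ▸ hL))).1 hL
    have hiff' (L : Subgroup (R × R'ᵐᵒᵖ)) : ((1, .op x) : R × R'ᵐᵒᵖ) ∈ L ↔
        ((1, .op y) : R × R'ᵐᵒᵖ) ∈ L := ⟨hiff hx1, hiff hy⟩
    refine congrArg₂ (· - ·) (fixCard_congr fun u => ?_) (fixCard_congr fun u => ?_)
    · exact hiff' (MulAction.stabilizer _ u)
    · have := hsplit x (MulAction.stabilizer _ u)
      rw [hiff', ← hsplit] at this
      exact this
  have htop := card_mul_moved_eq_sum U z (H := ⊤) Finset.univ (by simp)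
  rw [← Finset.add_sum_erase _ _ (Finset.mem_univ (1 : R')), Finset.sum_congr rfl hconst,
    Finset.sum_const, Finset.card_erase_of_mem (Finset.mem_univ _), Finset.card_univ,
    ← Nat.card_eq_fintype_card, nsmul_eq_mul, Nat.cast_sub hq.one_le, Nat.cast_one] at htop
  have hD := orderOf_mul_orderOf_dvd_of_coprime h
    (isCore_of_prime_card (hqop.symm ▸ hq) hyop)
    (by rwa [orderOf_of_prime_card (hqop.symm ▸ hq) hyop, hqop]) (U := U.carrier)
  rw [orderOf_of_prime_card (hqop.symm ▸ hq) hyop, hqop] at hD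
  have hDeq : fixCard U.carrier (1 : R × R'ᵐᵒᵖ) - fixCard U.carrier ((z, 1) : R × R'ᵐᵒᵖ) -
      fixCard U.carrier ((1, .op y) : R × R'ᵐᵒᵖ) + fixCard U.carrier ((z, .op y) : R × R'ᵐᵒᵖ) =
      fixDiff U z 1 - fixDiff U z y := by
    simp only [fixDiff, MulOpposite.op_one, ← Prod.one_eq_mk]
    ring
  rw [hDeq] at hD
  obtain ⟨m, hm⟩ := hD
  obtain ⟨l, hl⟩ := hodd
  have hq0 : (Nat.card R' : ℤ) ≠ 0 := by exact_mod_cast hq.ne_zero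
  rw [moved_tensor_bot]
  -- With `q = 2l + 1`, `q` times the difference is `(q - 1)D = 2lD`, and `D = |a| q m`; the
  -- required factor 2 comes from `q - 1`.
  refine ⟨l * m, mul_left_cancel₀ hq0 ?_⟩
  have hl' : (Nat.card R' : ℤ) = 2 * l + 1 := by exact_mod_cast hl
  push_cast at hm
  rw [mul_sub, htop]
  linear_combination (2 * (l : ℤ)) * hm + (fixDiff U z 1 - fixDiff U z y) * hl'

theorem two_mul_moved_sub (z : R) {T : Subgroup R'} {i : R'} (hi : i ≠ 1)
    (hT : ∀ x, x ∈ T ↔ x = 1 ∨ x = i) :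
    2 * ((moved z (U.tensor (FinGSet.coset R' ⊥)) : ℤ) -
      moved z (U.tensor (FinGSet.coset R' T))) = fixDiff U z 1 - fixDiff U z i := by
  classical
  have h1 := card_mul_moved_eq_sum U z (H := T) {1, i} (by simp [hT])
  rw [Finset.card_pair hi.symm, Finset.sum_pair hi.symm] at h1
  rw [moved_tensor_bot]
  push_cast at h1
  linear_combination -h1

/-- With `I = {1, i}` and `y` the central involution, `IZ = {1, i, y, iy}`. Since `iy` is conjugate
to `i`, the contributions of `i` and `iy` cancel. -/
theorem four_mul_moved_sub (z : R) {k : ℕ} {a' : R'} (h : IsTwoCore k 1 a') {I : Subgroup R'}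
    (hI : Nat.card I = 2) (hIZ : ¬ I ≤ Subgroup.center R') :
    4 * ((moved z (U.tensor (FinGSet.coset R' I)) : ℤ) -
      moved z (U.tensor (FinGSet.coset R' (I ⊔ Subgroup.center R')))) =
        fixDiff U z 1 - fixDiff U z (a' ^ 2 ^ (k - 1)) := by
  classical
  obtain ⟨i, hi1, hi2, hmem⟩ := exists_mem_iff_of_card_eq_two hI
  set y := a' ^ 2 ^ (k - 1) with hy
  have hic : i ∉ Subgroup.center R' := by
    refine fun hic => hIZ fun x hx => ?_
    rcases (hmem x).1 hx with rfl | rfl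
    · exact Subgroup.one_mem _
    · exact hic
  have hia : i ∉ Subgroup.zpowers a' := fun hia =>
    hic (h.mem_center_iff.2 (h.eq_one_or_eq hia hi2))
  have hiy : i ≠ y := fun hiy => hic (h.mem_center_iff.2 (Or.inr hiy))
  have hy1 : y ≠ 1 := h.isCore.ne_one
  obtain ⟨t, ht⟩ := h.exists_conj_eq_mul hia hi2
  have hconj : fixDiff U z (i * y) = fixDiff U z i := by rw [hy, ← ht, fixDiff_conj]
  have hiy1 : i * y ≠ 1 := by
    rw [← ht]
    simpa using hi1
  have h1 := card_mul_moved_eq_sum U z (H := I) {1, i} (by simp [hmem])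
  have h2 := card_mul_moved_eq_sum U z (H := I ⊔ Subgroup.center R') {1, i, y, i * y} (by
    intro x
    simp only [Subgroup.mem_sup_of_normal_right, hmem, h.mem_center_iff, ← hy]
    simp only [Finset.mem_insert, Finset.mem_singleton]
    constructor
    · rintro (rfl | rfl | rfl | rfl)
      · exact ⟨1, Or.inl rfl, 1, Or.inl rfl, by simp⟩
      · exact ⟨x, Or.inr rfl, 1, Or.inl rfl, by simp⟩
      · exact ⟨1, Or.inl rfl, y, Or.inr rfl, by simp⟩
      · exact ⟨i, Or.inr rfl, y, Or.inr rfl, by simp⟩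
    · rintro ⟨u, rfl | rfl, v, rfl | rfl, rfl⟩ <;> simp)
  rw [Finset.card_pair hi1.symm, Finset.sum_pair hi1.symm] at h1
  have hnot : (1 : R') ∉ ({i, y, i * y} : Finset R') := by
    simp [hi1.symm, hy1.symm, hiy1.symm]
  have hnot' : i ∉ ({y, i * y} : Finset R') := by simp [hiy, hy1]
  have hnot'' : y ≠ i * y := by simpa using hi1
  rw [Finset.card_insert_of_notMem hnot, Finset.card_insert_of_notMem hnot',
    Finset.card_pair hnot'', Finset.sum_insert hnot, Finset.sum_insert hnot',
    Finset.sum_pair hnot'', hconj] at h2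
  push_cast at h1 h2
  linear_combination 2 * h1 - h2

end Tensor

/-! ### Separation of the generators -/

/-- The group `R` has odd prime order and is generated by `a`, or it is a `2`-group as in
`IsTwoCore` and `z` is the involution of `⟨a⟩`. -/
def IsFamilyCore {R : Type} [Group R] (a z : R) : Prop :=
  ((Nat.card R).Prime ∧ Odd (Nat.card R) ∧ orderOf a = Nat.card R) ∨
    ∃ k e, e ≤ 1 ∧ IsTwoCore k e a ∧ z = a ^ 2 ^ (k - 1)

/-- In each case the first coset space is a single free `⟨a⟩`-orbit, while `z` acts trivially on the
second. -/
theorem IsEpsilon.exists_core {R : Type} [Group R] [Finite R] {v : Burnside (ZMod 2) R}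
    (hv : IsEpsilon (ZMod 2) R v) :
    ∃ (a z : R) (h : IsCore a z), IsFamilyCore a z ∧ freeOrbitParity h v ≠ 0 := by
  cases hv with
  | prime hp hodd =>
    have : Nontrivial R := Finite.one_lt_card_iff_nontrivial.1 hp.one_lt
    obtain ⟨z, hz⟩ := exists_ne (1 : R)
    have ho := orderOf_of_prime_card hp hz
    refine ⟨z, z, isCore_of_prime_card hp hz, Or.inl ⟨hp, hodd, ho⟩, ?_⟩
    exact freeOrbitParity_coset_ne_zero _ (by simpa using hz) (Subgroup.mem_top z)
      (by rw [Subgroup.index_bot, ho])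
  | four hc h4 T hT =>
    obtain ⟨a, ha⟩ := exists_isTwoCore_of_isCyclic hc h4
    refine ⟨a, _, ha.isCore, Or.inr ⟨2, 0, zero_le_one, ha, rfl⟩, ?_⟩
    have htop := Subgroup.index_eq_one.1 ha.index_eq
    obtain ⟨i, hi1, hi2, hmem⟩ := exists_mem_iff_of_card_eq_two hT
    have hi : i = a ^ 2 ^ (2 - 1) :=
      (ha.eq_one_or_eq (htop ▸ Subgroup.mem_top i) hi2).resolve_left hi1
    refine freeOrbitParity_coset_ne_zero _ (by simpa using ha.isCore.ne_one) ?_ ?_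
    · exact (hmem _).2 (Or.inr hi.symm)
    · rw [Subgroup.index_bot, ha.card_eq, ha.orderOf_eq]
  | semidihedral n hn hR I hI hIZ =>
    obtain ⟨a, -, ha, -, -⟩ := hR.exists_isTwoCore hn
    refine ⟨a, _, ha.isCore, Or.inr ⟨n - 1, 1, le_rfl, ha, rfl⟩, ?_⟩
    have hz : a ^ 2 ^ (n - 1 - 1) ∈ Subgroup.center R := ha.mem_center_iff.2 (Or.inr rfl)
    refine freeOrbitParity_coset_ne_zero _ ?_ (Subgroup.mem_sup_right hz) ?_
    · intro hzI
      obtain ⟨i, hi1, hi2, hmem⟩ := exists_mem_iff_of_card_eq_two hI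
      refine hIZ fun x hx => ?_
      rcases (hmem x).1 hx with rfl | rfl
      · exact Subgroup.one_mem _
      · rwa [← ((hmem _).1 hzI).resolve_left ha.isCore.ne_one]
    · have := I.card_mul_index
      rw [hI, ha.card_eq, pow_succ'] at this
      rw [ha.orderOf_eq]
      exact Nat.eq_of_mul_eq_mul_left two_pos this

theorem IsFamilyCore.dvd_fixDiff_sub {R R' : Type} [Group R] [Group R'] {a z : R}
    (h : IsCore a z) (hF : IsFamilyCore a z) (hne : Nat.card R ≠ Nat.card R') {k' e' : ℕ}
    (he' : e' ≤ 1) {a' : R'} (h' : IsTwoCore k' e' a') (U : FinBiset R R') :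
    2 ^ (e' + 2) * (orderOf a : ℤ) ∣ fixDiff U z 1 - fixDiff U z (a' ^ 2 ^ (k' - 1)) := by
  have hle' := h'.le
  have hDeq : fixDiff U z 1 - fixDiff U z (a' ^ 2 ^ (k' - 1)) =
      fixCard U.carrier (1 : R × R'ᵐᵒᵖ) - fixCard U.carrier ((z, 1) : R × R'ᵐᵒᵖ) -
      fixCard U.carrier ((1, .op a' ^ 2 ^ (k' - 1)) : R × R'ᵐᵒᵖ) +
      fixCard U.carrier ((z, .op a' ^ 2 ^ (k' - 1)) : R × R'ᵐᵒᵖ) := by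
    simp only [fixDiff, MulOpposite.op_one, ← Prod.one_eq_mk, MulOpposite.op_pow]
    ring
  rw [hDeq]
  rcases hF with ⟨hp, hodd, ho⟩ | ⟨k, e, he, ha, rfl⟩
  · refine dvd_trans ?_ (orderOf_mul_orderOf_dvd_of_coprime h h'.op.isCore ?_)
    · rw [h'.op.orderOf_eq]
      push_cast
      rw [mul_comm]
      exact mul_dvd_mul_left _ (pow_dvd_pow 2 hle')
    · rw [ho, h'.op.orderOf_eq]
      exact Nat.Coprime.pow_right _ (Nat.coprime_two_right.2 hodd)
  -- The value of `k` determines `e`: it is 0 for `k = 2` and 1 for larger `k`. Hence equal `k`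
  -- would mean equal group orders.
  · have hkk : k ≠ k' := by
      rintro rfl
      have hle := ha.le
      have h0 := ha.eq_two
      have h0' := h'.eq_two
      refine hne ?_
      rw [ha.card_eq, h'.card_eq, show e = e' by omega]
    refine dvd_trans (dvd_of_eq ?_) (ha.two_pow_dvd_fixCard h'.op hkk)
    rw [ha.orderOf_eq]
    push_cast
    ring

theorem IsEpsilon.mem_detected {R : Type} [Group R] {a z : R} (h : IsCore a z)
    (hF : IsFamilyCore a z) {R' : FiniteGrp.{0}} (hne : Nat.card R ≠ Nat.card R')
    {v : Burnside (ZMod 2) R'} (hv : IsEpsilon (ZMod 2) R' v) :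
    v ∈ (BurnsideSubfunctor.detected (freeOrbitParity h)).obj R' := by
  cases hv with
  | prime hp hodd =>
    refine sub_mem_detected h _ _ fun U => dvd_moved_sub_of_prime U h hp hodd ?_
    rcases hF with ⟨hp', -, ho⟩ | ⟨k, e, -, ha, -⟩
    · rw [ho]
      exact (Nat.coprime_primes hp' hp).2 hne
    · rw [ha.orderOf_eq]
      exact Nat.Coprime.pow_left _ (Nat.coprime_two_left.2 hodd)
  | four hc h4 T hT =>
    obtain ⟨a', ha'⟩ := exists_isTwoCore_of_isCyclic hc h4
    have htop := Subgroup.index_eq_one.1 ha'.index_eq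
    obtain ⟨i, hi1, hi2, hmem⟩ := exists_mem_iff_of_card_eq_two hT
    have hi : i = a' ^ 2 ^ (2 - 1) :=
      (ha'.eq_one_or_eq (htop ▸ Subgroup.mem_top i) hi2).resolve_left hi1
    refine sub_mem_detected h _ _ fun U => ?_
    have hD := IsFamilyCore.dvd_fixDiff_sub h hF hne zero_le_one ha' U
    rw [← hi, ← two_mul_moved_sub U z hi1 hmem] at hD
    refine Int.dvd_of_mul_dvd_mul_left two_ne_zero (dvd_trans (dvd_of_eq ?_) hD)
    ring
  | semidihedral n hn hR I hI hIZ =>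
    obtain ⟨a', -, ha', -, -⟩ := hR.exists_isTwoCore hn
    refine sub_mem_detected h _ _ fun U => ?_
    have hD := IsFamilyCore.dvd_fixDiff_sub h hF hne le_rfl ha' U
    rw [← four_mul_moved_sub U z ha' hI hIZ] at hD
    refine Int.dvd_of_mul_dvd_mul_left four_ne_zero (dvd_trans (dvd_of_eq ?_) hD)
    ring

/-! ### The family `S`: its members are told apart by their orders -/

namespace IsFamilyS

variable {S : Set FiniteGrp.{0}}

theorem eq_of_card_eq (hS : IsFamilyS S) {R R' : FiniteGrp.{0}} (hR : R ∈ S) (hR' : R' ∈ S)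
    (h : Nat.card R = Nat.card R') : R = R' := by
  have hpow {n : ℕ} (hn : 2 ≤ n) : ¬ (2 ^ n : ℕ).Prime := Nat.Prime.not_prime_pow hn
  have hpow4 {n : ℕ} (hn : 4 ≤ n) : 2 ^ n ≠ 4 := fun h4 => by
    have := Nat.pow_right_injective le_rfl (h4.trans (by norm_num : 4 = 2 ^ 2))
    omega
  have h4 : ¬ Nat.Prime 4 := by norm_num
  rcases hS.mem_type R hR with ⟨hp, ho⟩ | ⟨hc, hc4⟩ | ⟨n, hn, hsd⟩ <;>
    rcases hS.mem_type R' hR' with ⟨hp', -⟩ | ⟨hc', hc4'⟩ | ⟨m, hm, hsd'⟩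
  · exact (hS.prime _ hp ho).unique ⟨hR, rfl⟩ ⟨hR', h.symm⟩
  · rw [h, hc4'] at hp
    exact absurd hp h4
  · rw [h, hsd'.1] at hp
    exact absurd hp (hpow (by omega))
  · rw [← h, hc4] at hp'
    exact absurd hp' h4
  · exact hS.four.unique ⟨hR, hc, hc4⟩ ⟨hR', hc', hc4'⟩
  · rw [hc4, hsd'.1] at h
    exact absurd h.symm (hpow4 hm)
  · rw [← h, hsd.1] at hp'
    exact absurd hp' (hpow (by omega))
  · rw [hc4', hsd.1] at h
    exact absurd h (hpow4 hn)
  · rw [hsd.1, hsd'.1] at h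
    obtain rfl := Nat.pow_right_injective le_rfl h
    exact (hS.semidihedral n hn).unique ⟨hR, hsd⟩ ⟨hR', hsd'⟩

theorem isEpsilon_epsilon (hS : IsFamilyS S) {R : FiniteGrp.{0}} (hR : R ∈ S) :
    IsEpsilon (ZMod 2) R (epsilon (ZMod 2) R) := by
  have hex : ∃ v, IsEpsilon (ZMod 2) R v := by
    rcases hS.mem_type R hR with ⟨hp, ho⟩ | ⟨hc, hc4⟩ | ⟨n, hn, hsd⟩
    · exact ⟨_, .prime hp ho⟩
    · obtain ⟨a, ha⟩ := exists_isTwoCore_of_isCyclic hc hc4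
      exact ⟨_, .four hc hc4 (Subgroup.zpowers (a ^ 2 ^ (2 - 1)))
        (by rw [Nat.card_zpowers, ha.orderOf_pow])⟩
    · obtain ⟨a, b, ha, hb, hba⟩ := hsd.exists_isTwoCore hn
      refine ⟨_, .semidihedral n hn hsd (Subgroup.zpowers b) (by rw [Nat.card_zpowers, hb])
        fun hle => hba ?_⟩
      rcases ha.mem_center_iff.1 (hle (Subgroup.mem_zpowers b)) with rfl | rfl
      · exact Subgroup.one_mem _
      · exact Subgroup.npow_mem_zpowers a _
  rw [epsilon, dif_pos hex]
  exact hex.choose_spec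

/-- No element of `𝒢_S` lies in the subfunctor generated by the other ones. -/
theorem epsilon_notMem_generated (hS : IsFamilyS S) {R : FiniteGrp.{0}} (hR : R ∈ S)
    {𝒢 : Set (BurnsideSubfunctor.Element (ZMod 2))} (h𝒢 : 𝒢 ⊆ generators (S \ {R})) :
    epsilon (ZMod 2) R ∉ (BurnsideSubfunctor.generated 𝒢).obj R := by
  obtain ⟨a, z, h, hF, hne⟩ := (hS.isEpsilon_epsilon hR).exists_core
  intro hmem
  refine hne (BurnsideSubfunctor.apply_eq_zero_of_mem_detected (R := R)
    (BurnsideSubfunctor.generated_le (fun x hx => ?_) R hmem))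
  obtain ⟨R', ⟨hR', hRR'⟩, rfl⟩ := h𝒢 hx
  exact (hS.isEpsilon_epsilon hR').mem_detected h hF
    fun hcard => hRR' (hS.eq_of_card_eq hR hR' hcard).symm

end IsFamilyS

end BisetTheory
end

theorem theorem6p5 (S : Set FiniteGrp.{0}) (hS : BisetTheory.IsFamilyS S) :
    BisetTheory.BurnsideSubfunctor.IsMinimalGeneratingSet
      (BisetTheory.generators S) (BisetTheory.subfunctorL S) ∧
    ∀ S' : Set FiniteGrp.{0}, S' ⊂ S →
      BisetTheory.BurnsideSubfunctor.generated (BisetTheory.generators S') <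
        BisetTheory.subfunctorL S := by
  have hgen {R : FiniteGrp.{0}} (hR : R ∈ S) :
      BisetTheory.epsilon (ZMod 2) R ∈ (BisetTheory.subfunctorL S).obj R :=
    BisetTheory.BurnsideSubfunctor.mem_generated (x := ⟨R, BisetTheory.epsilon (ZMod 2) R⟩)
      ⟨R, hR, rfl⟩
  refine ⟨⟨rfl, fun 𝒢' h𝒢' heq => ?_⟩, fun S' hS' => ?_⟩
  · obtain ⟨x, ⟨R, hR, rfl⟩, hx⟩ := Set.exists_of_ssubset h𝒢'
    refine hS.epsilon_notMem_generated hR (𝒢 := 𝒢') (fun y hy => ?_) (heq ▸ hgen hR)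
    obtain ⟨R', hR', rfl⟩ := h𝒢'.1 hy
    refine ⟨R', ⟨hR', ?_⟩, rfl⟩
    rintro rfl
    exact hx hy
  · obtain ⟨R, hR, hRS'⟩ := Set.exists_of_ssubset hS'
    refine lt_of_le_not_ge
      (BisetTheory.BurnsideSubfunctor.generated_le ?_) fun hge => ?_
    · rintro _ ⟨R', hR', rfl⟩
      exact hgen (hS'.1 hR')
    -- Equality would place `ε_R`, for an `R` missing from `S'`, in the subfunctor generated by the
    -- others.
    · refine hS.epsilon_notMem_generated hR ?_ (hge R (hgen hR))
      rintro _ ⟨R', hR', rfl⟩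
      refine ⟨R', ⟨hS'.1 hR', ?_⟩, rfl⟩
      rintro rfl
      exact hRS' hR'
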